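/- Let $U_h=U_h(\mathfrak{sl}_2)$ be the $h$-adically complete unital associative algebra over $\mathbb{C}[[h]]$ topologically generated by $X,Y,H$ with relations $$[H,X]=2\,\frac{\sinh hX}{h},\qquad [H,Y]=-Y\cosh(hX)-\cosh(hX)\,Y,\qquad [X,Y]=H,$$ with coproduct (into the $h$-adically completed tensor product $U_h\hat\otimes U_h$) and antipode $$\Delta X=X\otimes 1+1\otimes X,\quad \Delta Y=Y\otimes e^{hX}+e^{-hX}\otimes Y,\quad \Delta H=H\otimes e^{hX}+e^{-hX}\otimes H,$$ $$S(X)=-X,\quad S(Y)=-e^{hX}Ye^{-hX},\quad S(H)=-e^{hX}He^{-hX}.$$ Write $a\triangleright b=\sum a_{(1)}\,b\,S(a_{(2)})$ for the left adjoint action. Let $$C=\tfrac{1}{2h}\bigl(Y\sinh(hX)+\sinh(hX)\,Y\bigr)+\tfrac14H^2+\tfrac14\sinh^2(hX),$$ $$X_h=e^{hX}\,\frac{\sinh hX}{h},\qquad H_h=He^{hX},\qquad Y_h=Ye^{hX}-2hC .$$ Then $C$ is central in $U_h$; the elements $X_h,H_h,Y_h$ are linearly independent over $\mathbb{C}[[h]]$;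 and their $\mathbb{C}[[h]]$-span $L$ is stable under the left adjoint action of $U_h$. Explicitly, $$\begin{aligned} X\triangleright X_h&=0,& H\triangleright X_h&=2X_h,& Y\triangleright X_h&=-H_h+2hX_h,\\ X\triangleright H_h&=-2X_h,& H\triangleright H_h&=4hX_h,& Y\triangleright H_h&=2Y_h+3h^2X_h,\\ X\triangleright Y_h&=H_h,& H\triangleright Y_h&=-2Y_h-2hH_h-h^2X_h,& Y\triangleright Y_h&=-2hY_h-h^2H_h-h^3X_h . \end{aligned}$$ The bracket $[a,b]:=a\triangleright b$ on $L$ is given by $$\begin{aligned} [X_h,X_h]&=0,&[X_h,H_h]&=-2X_h,&[X_h,Y_h]&=H_h-2hX_h,\\ [H_h,X_h]&=2X_h,&[H_h,H_h]&=0,&[H_h,Y_h]&=-2Y_h-2hH_h+h^2X_h,\\ [Y_h,X_h]&=-H_h-2hX_h,&[Y_h,H_h]&=2Y_h-2hH_h-h^2X_h,&[Y_h,Y_h]&=-4hY_h, \end{aligned}$$ and is $h$-antisymmetric: if $\sigma:L\to L$ is the additive involution that fixes $X_h,H_h,Y_h$ and satisfies $\sigma(f(h)\,a)=f(-h)\,\sigma(a)$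 for $f\in\mathbb{C}[[h]]$, then $\sigma([a,b])=-[\sigma(b),\sigma(a)]$ for all $a,b\in L$. Moreover $$\Delta(X_h)=1\otimes X_h+X_h\otimes e^{2hX},\qquad \Delta(H_h)=1\otimes H_h+H_h\otimes e^{2hX},$$ $$\Delta(Y_h)=1\otimes Y_h+Y_h\otimes e^{2hX}+2h\bigl(1\otimes C+C\otimes e^{2hX}-\Delta(C)\bigr).$$ -/

import Mathlib

open scoped TensorProduct

noncomputable section

namespace JordanianSl2

/-- The base ring `ℂ[[h]]`. -/
abbrev R : Type := PowerSeries ℂ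

/-- The deformation parameter `h ∈ ℂ[[h]]`. -/
abbrev h : R := PowerSeries.X

section Series

variable {A : Type*} [Ring A] [Algebra R A]

/-- `exp (h a)` modulo `h ^ n`: the sum of `h ^ k a ^ k / k!` over `k < n`. -/
def expT (n : ℕ) (a : A) : A :=
  ∑ k ∈ Finset.range n, (PowerSeries.monomial k ((k.factorial : ℂ)⁻¹) : R) • a ^ k

/-- `sinh (h a) / h` modulo `h ^ n`: the sum of `h ^ (2k) a ^ (2k+1) / (2k+1)!` over `k < n`. -/
def sinhDivT (n : ℕ) (a : A) : A :=
  ∑ k ∈ Finset.range n,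
    (PowerSeries.monomial (2 * k) (((2 * k + 1).factorial : ℂ)⁻¹) : R) • a ^ (2 * k + 1)

/-- `cosh (h a) = (exp (h a) + exp (- h a)) / 2` modulo `h ^ n`. -/
def coshT (n : ℕ) (a : A) : A :=
  (PowerSeries.C (1 / 2 : ℂ) : R) • (expT n a + expT n (-a))

/-- The defining relations of the Jordanian quantised enveloping algebra modulo `h ^ n`,
for elements `x, y, z` (standing for `X, Y, H`) of an algebra in which `h ^ n = 0`. -/
structure Sat (n : ℕ) (x y z : A) : Prop where
  pow : algebraMap R A (h ^ n) = 0
  zx : z * x - x * z = 2 * sinhDivT n x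
  zy : z * y - y * z = -(y * coshT n x) - coshT n x * y
  xy : x * y - y * x = z

end Series

/-- The names of the three generators. -/
inductive Gen : Type
  | X | Y | H

/-- The free algebra `ℂ[[h]]⟨X, Y, H⟩`. -/
abbrev Free : Type := FreeAlgebra R Gen

/-- The defining relations, together with `h ^ n = 0`. As `h ^ n = 0`, the series
`sinh (hX) / h` and `cosh (hX)` are the finite sums `sinhDivT n X` and `coshT n X`. -/
inductive Rel (n : ℕ) : Free → Free → Prop
  | pow : Rel n (algebraMap R Free (h ^ n)) 0
  | HX : Rel n (FreeAlgebra.ι R Gen.H * FreeAlgebra.ι R Gen.X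
        - FreeAlgebra.ι R Gen.X * FreeAlgebra.ι R Gen.H)
      (2 * sinhDivT n (FreeAlgebra.ι R Gen.X))
  | HY : Rel n (FreeAlgebra.ι R Gen.H * FreeAlgebra.ι R Gen.Y
        - FreeAlgebra.ι R Gen.Y * FreeAlgebra.ι R Gen.H)
      (-(FreeAlgebra.ι R Gen.Y * coshT n (FreeAlgebra.ι R Gen.X))
        - coshT n (FreeAlgebra.ι R Gen.X) * FreeAlgebra.ι R Gen.Y)
  | XY : Rel n (FreeAlgebra.ι R Gen.X * FreeAlgebra.ι R Gen.Y
        - FreeAlgebra.ι R Gen.Y * FreeAlgebra.ι R Gen.X)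
      (FreeAlgebra.ι R Gen.H)

/-- `U_h(sl_2) / h ^ n U_h(sl_2)`, by generators and relations. -/
def Level (n : ℕ) : Type := RingQuot (Rel n)

namespace Level

instance (n : ℕ) : Ring (Level n) := inferInstanceAs (Ring (RingQuot (Rel n)))

instance (n : ℕ) : Algebra R (Level n) := inferInstanceAs (Algebra R (RingQuot (Rel n)))

/-- The quotient map from the free algebra. -/
def mk (n : ℕ) : Free →ₐ[R] Level n := RingQuot.mkAlgHom R (Rel n)

theorem mk_rel {n : ℕ} {a b : Free} (hab : Rel n a b) : mk n a = mk n b :=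
  RingQuot.mkAlgHom_rel R hab

/-- The generator `X` modulo `h ^ n`. -/
def X (n : ℕ) : Level n := mk n (FreeAlgebra.ι R Gen.X)

/-- The generator `Y` modulo `h ^ n`. -/
def Y (n : ℕ) : Level n := mk n (FreeAlgebra.ι R Gen.Y)

/-- The generator `H` modulo `h ^ n`. -/
def H (n : ℕ) : Level n := mk n (FreeAlgebra.ι R Gen.H)

end Level

section SeriesLemmas

variable {A B : Type*} [Ring A] [Algebra R A] [Ring B] [Algebra R B]

theorem map_expT (f : A →ₐ[R] B) (n : ℕ) (a : A) : f (expT n a) = expT n (f a) := by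
  simp [expT, map_sum]

theorem map_sinhDivT (f : A →ₐ[R] B) (n : ℕ) (a : A) :
    f (sinhDivT n a) = sinhDivT n (f a) := by
  simp [sinhDivT, map_sum]

theorem map_coshT (f : A →ₐ[R] B) (n : ℕ) (a : A) : f (coshT n a) = coshT n (f a) := by
  simp [coshT, map_expT]

theorem smul_eq_zero_of_pow {n : ℕ} (hn : algebraMap R A (h ^ n) = 0) {m : ℕ} (hm : n ≤ m)
    (c : ℂ) (a : A) : (PowerSeries.monomial m c : R) • a = 0 := by
  have h1 : (PowerSeries.monomial m c : R) = PowerSeries.C c * h ^ (m - n) * h ^ n := by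
    rw [mul_assoc, ← pow_add, Nat.sub_add_cancel hm, PowerSeries.monomial_eq_mk, PowerSeries.X_pow_eq]
    ext k
    simp [PowerSeries.coeff_C_mul, PowerSeries.coeff_monomial]
  rw [h1, Algebra.smul_def, map_mul, hn]
  simp

theorem expT_eq_of_le {n : ℕ} (hn : algebraMap R A (h ^ n) = 0) {m : ℕ} (hm : n ≤ m) (a : A) :
    expT m a = expT n a := by
  unfold expT
  symm
  apply Finset.sum_subset (Finset.range_mono hm)
  intro k _ hk
  exact smul_eq_zero_of_pow hn (by simpa using hk) _ _

theorem sinhDivT_eq_of_le {n : ℕ} (hn : algebraMap R A (h ^ n) = 0) {m : ℕ} (hm : n ≤ m)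
    (a : A) : sinhDivT m a = sinhDivT n a := by
  unfold sinhDivT
  symm
  apply Finset.sum_subset (Finset.range_mono hm)
  intro k _ hk
  refine smul_eq_zero_of_pow hn ?_ _ _
  have : n ≤ k := by simpa using hk
  omega

theorem coshT_eq_of_le {n : ℕ} (hn : algebraMap R A (h ^ n) = 0) {m : ℕ} (hm : n ≤ m)
    (a : A) : coshT m a = coshT n a := by
  simp [coshT, expT_eq_of_le hn hm]

theorem Sat.map {n : ℕ} {x y z : A} (hs : Sat n x y z) (f : A →ₐ[R] B) :
    Sat n (f x) (f y) (f z) where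
  pow := by rw [← f.commutes, hs.pow, map_zero]
  zx := by rw [← map_sinhDivT, ← map_mul, ← map_mul, ← map_sub, hs.zx, map_mul, map_ofNat]
  zy := by
    rw [← map_coshT, ← map_mul, ← map_mul, ← map_sub, hs.zy]
    simp
  xy := by rw [← map_mul, ← map_mul, ← map_sub, hs.xy]

theorem Sat.succ {n : ℕ} {x y z : A} (hs : Sat n x y z) : Sat (n + 1) x y z where
  pow := by rw [pow_succ, map_mul, hs.pow, zero_mul]
  zx := by rw [sinhDivT_eq_of_le hs.pow (Nat.le_succ n), hs.zx]
  zy := by rw [coshT_eq_of_le hs.pow (Nat.le_succ n), hs.zy]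
  xy := hs.xy

theorem Level.sat (n : ℕ) : Sat n (Level.X n) (Level.Y n) (Level.H n) where
  pow := by
    have := Level.mk_rel (Rel.pow (n := n))
    rwa [AlgHom.commutes, map_zero] at this
  zx := by
    have := Level.mk_rel (Rel.HX (n := n))
    rwa [map_sub, map_mul, map_mul, map_mul, map_sinhDivT, map_ofNat] at this
  zy := by
    have := Level.mk_rel (Rel.HY (n := n))
    rwa [map_sub, map_mul, map_mul, map_sub, map_neg, map_mul, map_mul, map_coshT] at this
  xy := by
    have := Level.mk_rel (Rel.XY (n := n))
    rwa [map_sub, map_mul, map_mul] at this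

/-- The images of the generators under `X ↦ x`, `Y ↦ y`, `H ↦ z`. -/
def genVal (x y z : A) : Gen → A
  | Gen.X => x
  | Gen.Y => y
  | Gen.H => z

/-- The algebra homomorphism with `X ↦ x`, `Y ↦ y`, `H ↦ z`. -/
def Level.lift {n : ℕ} {x y z : A} (hs : Sat n x y z) : Level n →ₐ[R] A :=
  RingQuot.liftAlgHom R ⟨FreeAlgebra.lift R (genVal x y z), by
    intro a b hab
    cases hab with
    | pow => rw [AlgHom.commutes, hs.pow, map_zero]
    | HX =>
      have := hs.zx
      rw [map_sub, map_mul, map_mul, map_mul, map_sinhDivT, map_ofNat]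
      simp only [FreeAlgebra.lift_ι_apply]
      exact this
    | HY =>
      have := hs.zy
      rw [map_sub, map_mul, map_mul, map_sub, map_neg, map_mul, map_mul, map_coshT]
      simp only [FreeAlgebra.lift_ι_apply]
      exact this
    | XY =>
      have := hs.xy
      rw [map_sub, map_mul, map_mul]
      simp only [FreeAlgebra.lift_ι_apply]
      exact this⟩

theorem Level.lift_mk {n : ℕ} {x y z : A} (hs : Sat n x y z) (g : Gen) :
    Level.lift hs (Level.mk n (FreeAlgebra.ι R g)) = genVal x y z g :=
  (RingQuot.liftAlgHom_mkAlgHom_apply R _ _ _).trans (FreeAlgebra.lift_ι_apply _ _)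

@[simp] theorem Level.lift_X {n : ℕ} {x y z : A} (hs : Sat n x y z) :
    Level.lift hs (Level.X n) = x := Level.lift_mk hs Gen.X

@[simp] theorem Level.lift_Y {n : ℕ} {x y z : A} (hs : Sat n x y z) :
    Level.lift hs (Level.Y n) = y := Level.lift_mk hs Gen.Y

@[simp] theorem Level.lift_H {n : ℕ} {x y z : A} (hs : Sat n x y z) :
    Level.lift hs (Level.H n) = z := Level.lift_mk hs Gen.H

theorem Level.hom_ext {n : ℕ} {f g : Level n →ₐ[R] A} (hX : f (Level.X n) = g (Level.X n))
    (hY : f (Level.Y n) = g (Level.Y n)) (hH : f (Level.H n) = g (Level.H n)) : f = g := by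
  refine RingQuot.ringQuot_ext' R _ _ ?_
  apply FreeAlgebra.hom_ext
  funext i
  cases i
  · exact hX
  · exact hY
  · exact hH

/-! ### Identities for the truncated series -/

theorem monomial_eq (k : ℕ) (c : ℂ) :
    (PowerSeries.monomial k c : R) = PowerSeries.C c * h ^ k := by
  rw [PowerSeries.monomial_eq_mk, PowerSeries.X_pow_eq]
  ext j
  simp [PowerSeries.coeff_C_mul, PowerSeries.coeff_monomial]

theorem C_half_add : (PowerSeries.C (1 / 2 : ℂ) : R) + PowerSeries.C (1 / 2 : ℂ) = 1 := by
  rw [← map_add]; norm_num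

theorem expT_add {n : ℕ} (hn : algebraMap R A (h ^ n) = 0) {a b : A} (hab : Commute a b) :
    expT n (a + b) = expT n a * expT n b := by
  let _ : Algebra ℚ A := Algebra.compHom A (algebraMap ℚ R)
  have key : ∀ a : A, (h • a) ^ n = 0 ∧ expT n a = IsNilpotent.exp (h • a) := by
    intro a
    have h0 : (h • a) ^ n = 0 := by
      rw [smul_pow, Algebra.smul_def, hn, zero_mul]
    refine ⟨h0, ?_⟩
    rw [IsNilpotent.exp_eq_sum h0]
    unfold expT
    refine Finset.sum_congr rfl fun k _ => ?_
    have : ((k.factorial : ℚ)⁻¹ : ℚ) • (h • a) ^ k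
        = (algebraMap ℚ R ((k.factorial : ℚ)⁻¹)) • (h • a) ^ k := rfl
    rw [this, smul_pow, smul_smul, monomial_eq]
    congr 2
    have : (algebraMap ℚ R) = (PowerSeries.C (R := ℂ)).comp (algebraMap ℚ ℂ) :=
      RingHom.ext_rat _ _
    rw [this]
    simp
  rw [(key a).2, (key b).2, (key (a + b)).2, smul_add]
  refine IsNilpotent.exp_add_of_commute ?_ ⟨n, (key a).1⟩ ⟨n, (key b).1⟩
  exact (hab.smul_left h).smul_right h

theorem expT_zero {n : ℕ} (hn : algebraMap R A (h ^ n) = 0) : expT n (0 : A) = 1 := by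
  rcases n with _ | n
  · have : (1 : A) = 0 := by simpa using hn
    simp [expT, this]
  · rw [expT, Finset.sum_range_succ']
    simp

theorem expT_mul_neg {n : ℕ} (hn : algebraMap R A (h ^ n) = 0) (a : A) :
    expT n a * expT n (-a) = 1 := by
  rw [← expT_add hn (Commute.neg_right (Commute.refl a)), add_neg_cancel, expT_zero hn]

theorem expT_neg_mul {n : ℕ} (hn : algebraMap R A (h ^ n) = 0) (a : A) :
    expT n (-a) * expT n a = 1 := by
  rw [← expT_add hn (Commute.neg_left (Commute.refl a)), neg_add_cancel, expT_zero hn]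

theorem expT_commute {a b : A} (hab : Commute b a) (n : ℕ) : Commute b (expT n a) :=
  Commute.sum_right _ _ _ fun _ _ => (hab.pow_right _).smul_right _

theorem sinhDivT_commute {a b : A} (hab : Commute b a) (n : ℕ) : Commute b (sinhDivT n a) :=
  Commute.sum_right _ _ _ fun _ _ => (hab.pow_right _).smul_right _

theorem sinhDivT_neg (n : ℕ) (a : A) : sinhDivT n (-a) = -sinhDivT n a := by
  rw [sinhDivT, sinhDivT, ← Finset.sum_neg_distrib]
  refine Finset.sum_congr rfl fun k _ => ?_
  rw [Odd.neg_pow ⟨k, rfl⟩, smul_neg]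

theorem coshT_neg (n : ℕ) (a : A) : coshT n (-a) = coshT n a := by
  rw [coshT, coshT, neg_neg, add_comm]

theorem two_h_sinhDivT {n : ℕ} (hn : algebraMap R A (h ^ n) = 0) (a : A) :
    h • (2 * sinhDivT n a) = expT n a - expT n (-a) := by
  have key : ∀ m : ℕ, h • (2 * sinhDivT m a) = expT (2 * m) a - expT (2 * m) (-a) := by
    intro m
    induction m with
    | zero => simp [sinhDivT, expT]
    | succ m ih =>
      have e1 : ∀ b : A, expT (2 * (m + 1)) b = expT (2 * m) b
          + (PowerSeries.monomial (2 * m) (((2 * m).factorial : ℂ)⁻¹) : R) • b ^ (2 * m)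
          + (PowerSeries.monomial (2 * m + 1) (((2 * m + 1).factorial : ℂ)⁻¹) : R)
            • b ^ (2 * m + 1) := by
        intro b
        rw [expT, show 2 * (m + 1) = 2 * m + 1 + 1 by ring, Finset.sum_range_succ,
          Finset.sum_range_succ, ← expT]
      have e2 : sinhDivT (m + 1) a = sinhDivT m a
          + (PowerSeries.monomial (2 * m) (((2 * m + 1).factorial : ℂ)⁻¹) : R)
            • a ^ (2 * m + 1) := by
        rw [sinhDivT, Finset.sum_range_succ, ← sinhDivT]
      rw [e1, e1, e2, mul_add, smul_add, ih, Even.neg_pow ⟨m, by ring⟩, Odd.neg_pow ⟨m, rfl⟩]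
      have e3 : (PowerSeries.monomial (2 * m + 1) (((2 * m + 1).factorial : ℂ)⁻¹) : R)
          = h * PowerSeries.monomial (2 * m) (((2 * m + 1).factorial : ℂ)⁻¹) := by
        rw [monomial_eq, monomial_eq]; ring
      rw [e3, two_mul (PowerSeries.monomial _ _ • _), smul_add, smul_neg, mul_smul]
      abel
  rw [key, expT_eq_of_le hn (m := 2 * n) (by omega), expT_eq_of_le hn (m := 2 * n) (by omega)]

theorem two_coshT (n : ℕ) (a : A) : 2 * coshT n a = expT n a + expT n (-a) := by
  rw [coshT, two_mul, ← add_smul, C_half_add, one_smul]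

/-- Termwise differentiation of the truncated exponential series. -/
theorem sum_shift {n : ℕ} (hn : algebraMap R A (h ^ n) = 0) (v : ℕ → A) :
    ∑ k ∈ Finset.range n, (PowerSeries.monomial k ((k.factorial : ℂ)⁻¹) : R) • (k • v (k - 1))
      = h • ∑ k ∈ Finset.range n,
          (PowerSeries.monomial k ((k.factorial : ℂ)⁻¹) : R) • v k := by
  rcases n with _ | n
  · simp
  rw [Finset.sum_range_succ', Finset.sum_range_succ _ n, smul_add]
  have e3 : ∀ (k : ℕ) (c : ℂ), (PowerSeries.monomial (k + 1) c : R)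
      = h * PowerSeries.monomial k c := by
    intro k c
    rw [monomial_eq, monomial_eq]; ring
  rw [smul_smul h, ← e3, smul_eq_zero_of_pow hn le_rfl, zero_smul, smul_zero, Finset.smul_sum]
  congr 1
  refine Finset.sum_congr rfl fun k _ => ?_
  rw [Nat.add_sub_cancel, smul_smul h, ← e3, ← Nat.cast_smul_eq_nsmul R, smul_smul]
  congr 1
  rw [monomial_eq, monomial_eq, Nat.factorial_succ]
  have : ((k + 1 : ℕ) : R) = PowerSeries.C ((k + 1 : ℕ) : ℂ) := by simp
  rw [this, mul_right_comm, ← map_mul]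
  congr 2
  have h1 : ((k + 1 : ℕ) : ℂ) ≠ 0 := by exact_mod_cast Nat.succ_ne_zero k
  have h2 : (k.factorial : ℂ) ≠ 0 := by exact_mod_cast Nat.factorial_ne_zero k
  push_cast at *
  field_simp

end SeriesLemmas

section Commutation

variable {A : Type*} [Ring A] [Algebra R A] {n : ℕ} {x y z : A}

theorem Sat.z_pow (hs : Sat n x y z) (k : ℕ) :
    z * x ^ k = x ^ k * z + 2 * sinhDivT n x * (k • x ^ (k - 1)) := by
  have hc : x * sinhDivT n x = sinhDivT n x * x := sinhDivT_commute (Commute.refl x) n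
  have hz : z * x = x * z + 2 * sinhDivT n x := by rw [← hs.zx]; abel
  have hp : ∀ j : ℕ, x ^ j * sinhDivT n x = sinhDivT n x * x ^ j :=
    fun j => (sinhDivT_commute (Commute.refl x) n).pow_left j
  induction k with
  | zero => simp
  | succ k ih =>
    have h2 : k • (x ^ (k - 1) * x) = k • x ^ k := by
      rcases k with _ | k
      · simp
      · rw [Nat.add_sub_cancel, ← pow_succ]
    calc z * x ^ (k + 1) = (z * x ^ k) * x := by rw [pow_succ, mul_assoc]
      _ = x ^ k * (z * x) + 2 * sinhDivT n x * (k • (x ^ (k - 1) * x)) := by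
          rw [ih, add_mul, mul_assoc, mul_assoc, smul_mul_assoc]
      _ = x ^ (k + 1) * z + 2 * (x ^ k * sinhDivT n x)
            + 2 * sinhDivT n x * (k • x ^ k) := by
          rw [h2, hz, pow_succ]; noncomm_ring
      _ = _ := by
          rw [hp, Nat.add_sub_cancel, succ_nsmul]; noncomm_ring

theorem Sat.pow_y (hs : Sat n x y z) (k : ℕ) :
    x ^ k * y = y * x ^ k + z * (k • x ^ (k - 1))
      - sinhDivT n x * (k • ((k - 1) • x ^ (k - 1 - 1))) := by
  have hz : x * z = z * x - 2 * sinhDivT n x := by rw [← hs.zx]; abel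
  have hy : x * y = y * x + z := by
    have := hs.xy
    rw [← this]; abel
  have hc : x * sinhDivT n x = sinhDivT n x * x := sinhDivT_commute (Commute.refl x) n
  induction k with
  | zero => simp
  | succ k ih =>
    have h2 : k • (x * x ^ (k - 1)) = k • x ^ k := by
      rcases k with _ | k
      · simp
      · rw [Nat.add_sub_cancel, ← pow_succ']
    have h3 : k • ((k - 1) • (x * x ^ (k - 1 - 1))) = k • ((k - 1) • x ^ (k - 1)) := by
      rcases k with _ | _ | k
      · simp
      · simp
      · rw [Nat.add_sub_cancel, Nat.add_sub_cancel, ← pow_succ']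
    have h4 : (k + 1) • (k • x ^ (k - 1)) = k • ((k - 1) • x ^ (k - 1)) + 2 • (k • x ^ (k - 1)) := by
      rcases k with _ | k
      · simp
      · rw [Nat.add_sub_cancel, smul_smul, smul_smul, smul_smul, ← add_smul]
        congr 1; ring
    calc x ^ (k + 1) * y = x * (x ^ k * y) := by rw [pow_succ', mul_assoc]
      _ = (x * y) * x ^ k + (x * z) * (k • x ^ (k - 1))
            - (x * sinhDivT n x) * (k • ((k - 1) • x ^ (k - 1 - 1))) := by
          rw [ih]; noncomm_ring
      _ = y * x ^ (k + 1) + z * x ^ k + z * (k • (x * x ^ (k - 1)))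
            - 2 * sinhDivT n x * (k • x ^ (k - 1))
            - sinhDivT n x * (k • ((k - 1) • (x * x ^ (k - 1 - 1)))) := by
          rw [hy, hz, hc, pow_succ' x k]
          simp only [add_mul, sub_mul, mul_assoc, mul_smul_comm, smul_sub]
          abel
      _ = _ := by
          rw [h2, h3, Nat.add_sub_cancel, h4, succ_nsmul]
          simp only [two_mul, two_nsmul, mul_add, add_mul]
          abel

theorem Sat.z_exp (hs : Sat n x y z) :
    z * expT n x = expT n x * z + h • (2 * sinhDivT n x * expT n x) := by
  have h1 := sum_shift hs.pow (fun k => x ^ k)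
  have : z * expT n x = expT n x * z + 2 * sinhDivT n x *
      ∑ k ∈ Finset.range n, (PowerSeries.monomial k ((k.factorial : ℂ)⁻¹) : R)
        • (k • x ^ (k - 1)) := by
    rw [expT, Finset.mul_sum, Finset.mul_sum, Finset.sum_mul, ← Finset.sum_add_distrib]
    refine Finset.sum_congr rfl fun k _ => ?_
    rw [mul_smul_comm, hs.z_pow, smul_add, smul_mul_assoc]
    simp only [mul_smul_comm]
  rw [this, h1, mul_smul_comm]
  rfl

theorem Sat.exp_y (hs : Sat n x y z) :
    expT n x * y = y * expT n x + h • (z * expT n x)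
      - h • (h • (sinhDivT n x * expT n x)) := by
  have h1 := sum_shift hs.pow (fun k => x ^ k)
  have h2 := sum_shift hs.pow (fun k => k • x ^ (k - 1))
  have : expT n x * y = y * expT n x
      + z * ∑ k ∈ Finset.range n, (PowerSeries.monomial k ((k.factorial : ℂ)⁻¹) : R)
        • (k • x ^ (k - 1))
      - sinhDivT n x * ∑ k ∈ Finset.range n,
        (PowerSeries.monomial k ((k.factorial : ℂ)⁻¹) : R)
        • (k • ((k - 1) • x ^ (k - 1 - 1))) := by
    rw [expT, Finset.mul_sum, Finset.mul_sum, Finset.mul_sum, Finset.sum_mul,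
      ← Finset.sum_add_distrib, ← Finset.sum_sub_distrib]
    refine Finset.sum_congr rfl fun k _ => ?_
    rw [smul_mul_assoc, hs.pow_y, smul_sub, smul_add]
    simp only [mul_smul_comm]
  rw [this, h2, h1, mul_smul_comm, mul_smul_comm, mul_smul_comm]
  rfl

theorem sinhDivT_add_dvd {S : Type*} [CommRing S] [Algebra R S] [IsDomain S]
    (h3 : algebraMap R S h ≠ 0) (n : ℕ) (α β : S) :
    ∃ q : S, 2 * sinhDivT (n + 1) (α + β)
      - (2 * (sinhDivT (n + 1) α * coshT (n + 1) β) + 2 * (coshT (n + 1) α * sinhDivT (n + 1) β))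
      = algebraMap R S (h ^ n) * q := by
  let N := n + 1
  let J : Ideal S := Ideal.span {algebraMap R S (h ^ N)}
  let ψ : S →ₐ[R] S ⧸ J := Ideal.Quotient.mkₐ R J
  have hN : algebraMap R (S ⧸ J) (h ^ N) = 0 := by
    rw [← ψ.commutes]
    exact Ideal.Quotient.eq_zero_iff_mem.2 (Ideal.subset_span rfl)
  let p : S := 2 * sinhDivT N (α + β)
    - (2 * (sinhDivT N α * coshT N β) + 2 * (coshT N α * sinhDivT N β))
  have hp : h • ψ p = 0 := by
    have c2 : ∀ u : S ⧸ J, h • u = algebraMap R _ h * u := fun u => Algebra.smul_def _ _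
    have key : ∀ u : S ⧸ J, algebraMap R _ h * (2 * sinhDivT N u) = expT N u - expT N (-u) :=
      fun u => by rw [← c2, two_h_sinhDivT hN]
    have e1 := key (ψ α)
    have e2 := key (ψ β)
    have e3 := key (ψ α + ψ β)
    rw [neg_add, expT_add hN (Commute.all _ _), expT_add hN (Commute.all _ _)] at e3
    have e4 := two_coshT N (ψ α)
    have e5 := two_coshT N (ψ β)
    have e6 : algebraMap R (S ⧸ J) (PowerSeries.C (1 / 2 : ℂ)) * 2 = 1 := by
      rw [mul_two, ← map_add, C_half_add, map_one]
    have e7 : 2 * (h • ψ p) = 0 := by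
      rw [c2]
      simp only [p, map_sub, map_add, map_mul, map_ofNat, map_sinhDivT, map_coshT]
      linear_combination 2 * e3 - 2 * coshT N (ψ β) * e1 - 2 * coshT N (ψ α) * e2
        - (expT N (ψ α) - expT N (-ψ α)) * e5 - (expT N (ψ β) - expT N (-ψ β)) * e4
    calc h • ψ p = (algebraMap R (S ⧸ J) (PowerSeries.C (1 / 2 : ℂ)) * 2) * (h • ψ p) := by
          rw [e6, one_mul]
      _ = 0 := by rw [mul_assoc, e7, mul_zero]
  have h1 : ψ (algebraMap R S h * p) = 0 := by
    rw [← Algebra.smul_def, map_smul, hp]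
  have h2 : algebraMap R S h * p ∈ J := Ideal.Quotient.eq_zero_iff_mem.1 h1
  obtain ⟨q, hq⟩ := Ideal.mem_span_singleton'.1 h2
  refine ⟨q, ?_⟩
  apply mul_left_cancel₀ h3
  change algebraMap R S h * p = _
  rw [← hq, ← mul_assoc, ← map_mul, ← pow_succ', mul_comm]

theorem sinhDivT_add_map {S : Type*} [CommRing S] [Algebra R S] [IsDomain S]
    (h3 : algebraMap R S h ≠ 0) (hn : algebraMap R A (h ^ n) = 0) (φ : S →ₐ[R] A) (α β : S) :
    2 * sinhDivT n (φ α + φ β) = 2 * (sinhDivT n (φ α) * coshT n (φ β))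
      + 2 * (coshT n (φ α) * sinhDivT n (φ β)) := by
  obtain ⟨q, hq⟩ := sinhDivT_add_dvd h3 n α β
  have hφp := congrArg φ hq
  have hle : n ≤ n + 1 := Nat.le_succ n
  simp only [map_sub, map_add, map_mul, map_ofNat, map_sinhDivT, map_coshT,
    φ.commutes, hn, zero_mul, sinhDivT_eq_of_le hn hle, coshT_eq_of_le hn hle] at hφp
  exact sub_eq_zero.1 hφp

/-- The addition theorem for `sinh`, divided by `h`. -/
theorem sinhDivT_add (hn : algebraMap R A (h ^ n) = 0) {a b : A} (hab : Commute a b) :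
    2 * sinhDivT n (a + b)
      = 2 * (sinhDivT n a * coshT n b) + 2 * (coshT n a * sinhDivT n b) := by
  let α : Polynomial (Polynomial R) := Polynomial.C Polynomial.X
  let β : Polynomial (Polynomial R) := Polynomial.X
  have h3 : algebraMap R (Polynomial (Polynomial R)) h ≠ 0 := by
    have : Function.Injective (algebraMap R (Polynomial (Polynomial R))) :=
      FaithfulSMul.algebraMap_injective _ _
    rw [Ne, ← map_zero (algebraMap R (Polynomial (Polynomial R))), this.eq_iff]
    exact PowerSeries.X_ne_zero
  let f0 : Polynomial R →ₐ[R] A := Polynomial.aeval a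
  have hf0 : ∀ r, Commute (f0 r) b := by
    intro r
    induction r using Polynomial.induction_on' with
    | add r s hr hs => rw [map_add]; exact hr.add_left hs
    | monomial k c =>
      rw [Polynomial.aeval_monomial]
      exact Commute.mul_left (Algebra.commutes c b) (hab.pow_left k)
  let φ0 : Polynomial (Polynomial R) →+* A := Polynomial.eval₂RingHom' (f0 : Polynomial R →+* A) b hf0
  let φ : Polynomial (Polynomial R) →ₐ[R] A :=
    { φ0 with
      commutes' := fun r => by
        have : algebraMap R (Polynomial (Polynomial R)) r = Polynomial.C (Polynomial.C r) := rfl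
        change φ0 (algebraMap R (Polynomial (Polynomial R)) r) = _
        rw [this]
        simp [φ0, f0, Polynomial.eval₂RingHom'] }
  have hφα : φ α = a := by
    change φ0 α = a
    simp [φ0, f0, α, Polynomial.eval₂RingHom']
  have hφβ : φ β = b := by
    change φ0 β = b
    simp [φ0, f0, β, Polynomial.eval₂RingHom']
  have := sinhDivT_add_map h3 hn φ α β
  rwa [hφα, hφβ] at this

theorem Sat.z_exp' (hs : Sat n x y z) :
    z * expT n x = expT n x * z + expT n x * expT n x - 1 := by
  rw [hs.z_exp, ← smul_mul_assoc, two_h_sinhDivT hs.pow, sub_mul, expT_neg_mul hs.pow,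
    add_sub_assoc]

theorem Sat.z_exp_neg (hs : Sat n x y z) :
    z * expT n (-x) = expT n (-x) * z + expT n (-x) * expT n (-x) - 1 := by
  have h1 := expT_neg_mul hs.pow x
  have h2 := expT_mul_neg hs.pow x
  have h3 := congrArg (fun w => expT n (-x) * w * expT n (-x)) hs.z_exp'
  simp only [mul_add, mul_sub, add_mul, sub_mul, mul_one, ← mul_assoc, h1, one_mul] at h3
  rw [mul_assoc, mul_assoc, h2, mul_one] at h3
  rw [h3]; abel

theorem Sat.exp_y' (hs : Sat n x y z) :
    2 • (expT n x * y) = 2 • (y * expT n x) + 2 • h • (z * expT n x)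
      - h • (expT n x * expT n x - 1) := by
  have h1 : expT n x * expT n x - 1 = h • (2 • (sinhDivT n x * expT n x)) := by
    have : 2 • (sinhDivT n x * expT n x) = 2 * sinhDivT n x * expT n x := by
      rw [two_nsmul, two_mul, add_mul]
    rw [this, ← smul_mul_assoc, two_h_sinhDivT hs.pow, sub_mul, expT_neg_mul hs.pow]
  rw [h1, hs.exp_y]
  simp only [two_nsmul, smul_add]
  abel

theorem Sat.exp_neg_y (hs : Sat n x y z) :
    2 • (expT n (-x) * y) = 2 • (y * expT n (-x))
      - 2 • h • (expT n (-x) * z) + h • (1 - expT n (-x) * expT n (-x)) := by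
  have h1 := expT_neg_mul hs.pow x
  have h2 := expT_mul_neg hs.pow x
  have h3 := congrArg (fun w => expT n (-x) * w * expT n (-x)) hs.exp_y'
  simp only [mul_add, mul_sub, add_mul, sub_mul, mul_one, mul_smul_comm, smul_mul_assoc,
    ← mul_assoc, h1, one_mul] at h3
  rw [mul_assoc (expT n (-x) * y), mul_assoc (expT n (-x) * z), h2, mul_one, mul_one] at h3
  rw [h3]
  abel

open TensorProduct in
/-- The images of the generators under the coproduct satisfy the defining relations. -/
theorem Sat.comul (hs : Sat n x y z) :
    Sat n (x ⊗ₜ[R] (1 : A) + (1 : A) ⊗ₜ[R] x)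
      (y ⊗ₜ[R] expT n x + expT n (-x) ⊗ₜ[R] y)
      (z ⊗ₜ[R] expT n x + expT n (-x) ⊗ₜ[R] z) := by
  have hn : algebraMap R (A ⊗[R] A) (h ^ n) = 0 := by
    rw [Algebra.TensorProduct.algebraMap_apply, hs.pow, zero_tmul]
  have hL : ∀ (w : A), w ⊗ₜ[R] (1 : A) = Algebra.TensorProduct.includeLeft (S := R) w :=
    fun w => rfl
  have hR : ∀ (w : A), (1 : A) ⊗ₜ[R] w = Algebra.TensorProduct.includeRight w :=
    fun w => rfl
  have hcomm : ∀ v w : A, Commute (v ⊗ₜ[R] (1 : A)) ((1 : A) ⊗ₜ[R] w) := by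
    intro v w
    simp [Commute, SemiconjBy]
  have hexp : ∀ w : A, expT n (w ⊗ₜ[R] (1 : A) + (1 : A) ⊗ₜ[R] w)
      = expT n w ⊗ₜ[R] expT n w := by
    intro w
    rw [expT_add hn (hcomm w w), hL, hR, ← map_expT, ← map_expT, ← hL, ← hR]
    simp
  have hneg : -(x ⊗ₜ[R] (1 : A) + (1 : A) ⊗ₜ[R] x)
      = (-x) ⊗ₜ[R] (1 : A) + (1 : A) ⊗ₜ[R] (-x) := by
    rw [neg_add, neg_tmul, tmul_neg]
  have hcosh : 2 * coshT n (x ⊗ₜ[R] (1 : A) + (1 : A) ⊗ₜ[R] x)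
      = expT n x ⊗ₜ[R] expT n x + expT n (-x) ⊗ₜ[R] expT n (-x) := by
    rw [two_coshT, hneg, hexp, hexp]
  have hsinh : 2 * sinhDivT n (x ⊗ₜ[R] (1 : A) + (1 : A) ⊗ₜ[R] x)
      = sinhDivT n x ⊗ₜ[R] (expT n x + expT n (-x))
        + (expT n x + expT n (-x)) ⊗ₜ[R] sinhDivT n x := by
    rw [sinhDivT_add hn (hcomm x x), ← two_coshT, two_mul (coshT n x), hL, hR, ← map_sinhDivT,
      ← map_sinhDivT, ← map_coshT, ← map_coshT, ← hL, ← hR, ← hL, ← hR]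
    simp only [Algebra.TensorProduct.tmul_mul_tmul, one_mul, mul_one, tmul_add, add_tmul, two_mul]
  have hxe : expT n x * x = x * expT n x := (expT_commute (Commute.refl x) n).symm
  have hxf : expT n (-x) * x = x * expT n (-x) :=
    (expT_commute (Commute.neg_right (Commute.refl x)) n).symm
  have h1 := expT_neg_mul hs.pow x
  have h2 := expT_mul_neg hs.pow x
  refine ⟨hn, ?_, ?_, ?_⟩
  · rw [hsinh]
    have hz : z * x = x * z + (sinhDivT n x + sinhDivT n x) := by
      rw [← two_mul, ← hs.zx]; abel
    have hef : expT n x = expT n (-x) + h • (sinhDivT n x + sinhDivT n x) := by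
      rw [← two_mul, two_h_sinhDivT hs.pow]; abel
    simp only [add_mul, mul_add, Algebra.TensorProduct.tmul_mul_tmul, one_mul, mul_one, hxe, hxf,
      hz]
    simp only [tmul_add, add_tmul]
    have e1 := congrArg (fun w => sinhDivT n x ⊗ₜ[R] w) hef
    have e2 := congrArg (fun w => w ⊗ₜ[R] sinhDivT n x) hef
    simp only [tmul_add, add_tmul, smul_add, tmul_smul, ← smul_tmul'] at e1 e2
    linear_combination (norm := abel) e1 - e2
  · generalize hc : coshT n (x ⊗ₜ[R] (1 : A) + (1 : A) ⊗ₜ[R] x) = c at hcosh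
    generalize hY : y ⊗ₜ[R] expT n x + expT n (-x) ⊗ₜ[R] y = Y at *
    generalize hZ : z ⊗ₜ[R] expT n x + expT n (-x) ⊗ₜ[R] z = Z at *
    have key : 4 • (Z * Y - Y * Z + Y * c + c * Y) = 0 := by
      have e0 : 4 • (Z * Y - Y * Z + Y * c + c * Y)
          = 4 • (Z * Y - Y * Z) + 2 • (Y * (2 * c) + (2 * c) * Y) := by
        simp only [two_mul, mul_add, add_mul]
        abel
      rw [e0, hcosh, ← hY, ← hZ]
      have E5 : 2 • (z * y) = 2 • (y * z) - y * expT n x - y * expT n (-x)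
          - expT n x * y - expT n (-x) * y := by
        have := congrArg (fun w => 2 • w) hs.zy
        have hcc := two_coshT n x
        have e : 2 • (-(y * coshT n x) - coshT n x * y)
            = -(y * (2 * coshT n x)) - (2 * coshT n x) * y := by
          simp only [two_mul, mul_add, add_mul]; abel
        simp only [e, hcc, smul_sub, mul_add, add_mul] at this
        rw [sub_eq_iff_eq_add] at this
        rw [this]; abel
      have E1 := hs.z_exp'
      have E2 := hs.z_exp_neg
      have E3 := hs.exp_y'
      have E4 := hs.exp_neg_y
      simp only [add_mul, mul_add, Algebra.TensorProduct.tmul_mul_tmul, h1, h2]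
      generalize expT n x = e at *
      generalize expT n (-x) = f at *
      have t1 := congrArg (fun w => w ⊗ₜ[R] (e * e)) E5
      have t2 := congrArg (fun w => (f * f) ⊗ₜ[R] w) E5
      have t3 := congrArg (fun w => w ⊗ₜ[R] (e * y)) E2
      have t4 := congrArg (fun w => (y * f) ⊗ₜ[R] w) E1
      have t5 := congrArg (fun w => (f * z) ⊗ₜ[R] w) E3
      have t6 := congrArg (fun w => w ⊗ₜ[R] (z * e)) E4
      have t7 := congrArg (fun w => w ⊗ₜ[R] (e * e)) E4
      have t8 := congrArg (fun w => w ⊗ₜ[R] (1 : A)) E4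
      have t9 := congrArg (fun w => (f * f) ⊗ₜ[R] w) E3
      have t10 := congrArg (fun w => (1 : A) ⊗ₜ[R] w) E3
      simp only [tmul_add, add_tmul, tmul_sub, sub_tmul, tmul_smul, ← smul_tmul', smul_sub, two_nsmul]
        at t1 t2 t3 t4 t5 t6 t7 t8 t9 t10
      linear_combination (norm := abel) 2 • t1 + 2 • t2 + 4 • t3 + 4 • t4
        + 2 • t5 + 2 • t6 - t7 + t8 + t9 - t10
    have h4 : (PowerSeries.C (1 / 4 : ℂ) : R) * 4 = 1 := by
      have : (4 : R) = PowerSeries.C (4 : ℂ) := (map_ofNat PowerSeries.C 4).symm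
      rw [this, ← map_mul]; norm_num
    have key2 := congrArg (fun w => (PowerSeries.C (1 / 4 : ℂ) : R) • w) key
    have h5 : ∀ w : A ⊗[R] A, (PowerSeries.C (1 / 4 : ℂ) : R) • (4 • w) = w := by
      intro w
      rw [← Nat.cast_smul_eq_nsmul R, smul_smul]
      rw [show ((4 : ℕ) : R) = 4 by norm_num, h4, one_smul]
    simp only [h5, smul_zero] at key2
    rw [← sub_eq_zero, ← key2]
    abel
  · have hz : x * y = y * x + z := by
      have := hs.xy
      rw [← this]; abel
    simp only [add_mul, mul_add, Algebra.TensorProduct.tmul_mul_tmul, one_mul, mul_one, hxe, hxf,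
      hz]
    simp only [tmul_add, add_tmul]
    abel

/-- The images of the generators under the antipode satisfy the defining relations in the
opposite algebra. -/
theorem Sat.antipode (hs : Sat n x y z) :
    Sat (A := Aᵐᵒᵖ) n (MulOpposite.op (-x)) (MulOpposite.op (-(expT n x * y * expT n (-x))))
      (MulOpposite.op (-(expT n x * z * expT n (-x)))) := by
  have hexp : ∀ w : A, expT n (MulOpposite.op w) = MulOpposite.op (expT n w) := by
    intro w
    simp [expT, Finset.op_sum]
  have hsinh : sinhDivT n (MulOpposite.op (-x)) = MulOpposite.op (-sinhDivT n x) := by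
    rw [← sinhDivT_neg]
    simp [sinhDivT, Finset.op_sum]
  have hcosh : coshT n (MulOpposite.op (-x)) = MulOpposite.op (coshT n x) := by
    rw [← coshT_neg n x, coshT, coshT, ← MulOpposite.op_neg, hexp, hexp]
    rfl
  have hxe : expT n x * x = x * expT n x := (expT_commute (Commute.refl x) n).symm
  have hxf : expT n (-x) * x = x * expT n (-x) :=
    (expT_commute (Commute.neg_right (Commute.refl x)) n).symm
  have h1 := expT_neg_mul hs.pow x
  have h2 := expT_mul_neg hs.pow x
  have hce : coshT n x * expT n x = expT n x * coshT n x := by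
    simp only [coshT, smul_mul_assoc, mul_smul_comm, add_mul, mul_add, h1, h2]
  have hcf : coshT n x * expT n (-x) = expT n (-x) * coshT n x := by
    simp only [coshT, smul_mul_assoc, mul_smul_comm, add_mul, mul_add, h1, h2]
  have hse : expT n x * sinhDivT n x * expT n (-x) = sinhDivT n x := by
    rw [(sinhDivT_commute (Commute.symm (expT_commute (Commute.refl x) n)) n).eq, mul_assoc, h2,
      mul_one]
  generalize he : expT n x = e at *
  generalize hf : expT n (-x) = f at *
  have r1 : ∀ a b : A, (e * a * f) * (e * b * f) = e * (a * b) * f := by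
    intro a b
    calc (e * a * f) * (e * b * f) = e * a * (f * e) * b * f := by simp only [mul_assoc]
      _ = _ := by rw [h1, mul_one, mul_assoc e a b]
  have r2 : ∀ a : A, x * (e * a * f) = e * (x * a) * f := by
    intro a
    rw [← mul_assoc, ← mul_assoc, ← hxe, mul_assoc e x a]
  have r3 : ∀ a : A, (e * a * f) * x = e * (a * x) * f := by
    intro a
    rw [mul_assoc, hxf, ← mul_assoc, mul_assoc e a x]
  have r4 : ∀ a : A, coshT n x * (e * a * f) = e * (coshT n x * a) * f := by
    intro a
    rw [← mul_assoc, ← mul_assoc, hce, mul_assoc e _ a]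
  have r5 : ∀ a : A, (e * a * f) * coshT n x = e * (a * coshT n x) * f := by
    intro a
    rw [mul_assoc, ← hcf, ← mul_assoc, mul_assoc e a]
  have sub : ∀ a b : A, e * a * f - e * b * f = e * (a - b) * f := by
    intro a b
    rw [mul_sub, sub_mul]
  refine ⟨?_, ?_, ?_, ?_⟩
  · rw [MulOpposite.algebraMap_apply, hs.pow, MulOpposite.op_zero]
  · apply MulOpposite.unop_injective
    rw [hsinh, two_mul]
    simp only [MulOpposite.unop_sub, MulOpposite.unop_mul, MulOpposite.unop_op, neg_mul_neg,
      MulOpposite.unop_add]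
    rw [r2, r3, sub, ← neg_sub, hs.zx, mul_neg, neg_mul, two_mul, mul_add, add_mul, hse]
    abel
  · apply MulOpposite.unop_injective
    rw [hcosh]
    simp only [MulOpposite.unop_sub, MulOpposite.unop_mul, MulOpposite.unop_op,
      MulOpposite.unop_neg, mul_neg, neg_mul, neg_neg, sub_neg_eq_add]
    rw [r1, r1, sub, r4, r5, ← neg_sub, hs.zy]
    noncomm_ring
  · apply MulOpposite.unop_injective
    simp only [MulOpposite.unop_sub, MulOpposite.unop_mul, MulOpposite.unop_op, neg_mul_neg]
    rw [r2, r3, sub, ← neg_sub, hs.xy]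
    noncomm_ring

end Commutation

/-! ### The structure maps modulo `h ^ n` -/

namespace Level

/-- Reduction from modulo `h ^ (n + 1)` to modulo `h ^ n`. -/
def proj (n : ℕ) : Level (n + 1) →ₐ[R] Level n := Level.lift (Level.sat n).succ

@[simp] theorem proj_X (n : ℕ) : proj n (X (n + 1)) = X n := lift_X _
@[simp] theorem proj_Y (n : ℕ) : proj n (Y (n + 1)) = Y n := lift_Y _
@[simp] theorem proj_H (n : ℕ) : proj n (H (n + 1)) = H n := lift_H _

/-- The coproduct: `Δ X = X ⊗ 1 + 1 ⊗ X`, `Δ Y = Y ⊗ exp (hX) + exp (-hX) ⊗ Y`,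
`Δ H = H ⊗ exp (hX) + exp (-hX) ⊗ H`. -/
def comul (n : ℕ) : Level n →ₐ[R] Level n ⊗[R] Level n := Level.lift (Level.sat n).comul

/-- The antipode, as a homomorphism to the opposite algebra: `S X = -X`,
`S Y = - exp (hX) Y exp (-hX)`, `S H = - exp (hX) H exp (-hX)`. -/
def antipode (n : ℕ) : Level n →ₐ[R] (Level n)ᵐᵒᵖ := Level.lift (Level.sat n).antipode

/-- The linear map `a ⊗ c ↦ a * b * S c`. -/
def contract (n : ℕ) (b : Level n) : Level n ⊗[R] Level n →ₗ[R] Level n :=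
  LinearMap.mul' R (Level n) ∘ₗ TensorProduct.map (LinearMap.mulRight R b)
    ((MulOpposite.opLinearEquiv R).symm.toLinearMap ∘ₗ (antipode n).toLinearMap)

/-- The left adjoint action `a ▷ b = ∑ a₍₁₎ b S(a₍₂₎)`. -/
def ad (n : ℕ) (a b : Level n) : Level n := contract n b (comul n a)

theorem proj_expT (n : ℕ) (a : Level (n + 1)) :
    proj n (expT (n + 1) a) = expT n (proj n a) := by
  rw [map_expT, expT_eq_of_le (Level.sat n).pow (Nat.le_succ n)]

theorem proj_sinhDivT (n : ℕ) (a : Level (n + 1)) :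
    proj n (sinhDivT (n + 1) a) = sinhDivT n (proj n a) := by
  rw [map_sinhDivT, sinhDivT_eq_of_le (Level.sat n).pow (Nat.le_succ n)]

theorem proj_comul (n : ℕ) (a : Level (n + 1)) :
    Algebra.TensorProduct.map (proj n) (proj n) (comul (n + 1) a) = comul n (proj n a) := by
  have : (Algebra.TensorProduct.map (proj n) (proj n)).comp (comul (n + 1))
      = (comul n).comp (proj n) := by
    apply Level.hom_ext <;> simp [comul, proj_expT]
  exact DFunLike.congr_fun this a

theorem proj_antipode (n : ℕ) (a : Level (n + 1)) :
    proj n (antipode (n + 1) a).unop = (antipode n (proj n a)).unop := by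
  have : (proj n).op.comp (antipode (n + 1)) = (antipode n).comp (proj n) := by
    apply Level.hom_ext <;> simp [antipode, proj_expT]
  exact congrArg MulOpposite.unop (DFunLike.congr_fun this a)

theorem proj_ad (n : ℕ) (a b : Level (n + 1)) :
    proj n (ad (n + 1) a b) = ad n (proj n a) (proj n b) := by
  have : (proj n).toLinearMap ∘ₗ contract (n + 1) b
      = contract n (proj n b) ∘ₗ (Algebra.TensorProduct.map (proj n) (proj n)).toLinearMap := by
    apply TensorProduct.ext'
    intro u v
    simp [contract, proj_antipode]
  rw [ad, ad, ← proj_comul]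
  exact DFunLike.congr_fun this _

end Level

/-! ### The `h`-adically complete objects -/

/-- The inverse limit of a tower of `ℂ[[h]]`-algebras. -/
def invLim (A : ℕ → Type) [∀ n, Ring (A n)] [∀ n, Algebra R (A n)]
    (π : ∀ n, A (n + 1) →ₐ[R] A n) : Subalgebra R (∀ n, A n) where
  carrier := {f | ∀ n, π n (f (n + 1)) = f n}
  mul_mem' := fun {f g} hf hg n => by simp [hf n, hg n]
  add_mem' := fun {f g} hf hg n => by simp [hf n, hg n]
  algebraMap_mem' := fun r n => by simp

/-- The Jordanian quantised enveloping algebra `U_h(sl_2)`: the `h`-adically complete algebra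
over `ℂ[[h]]` with (topological) generators `X, Y, H` and relations
`[H, X] = 2 sinh (hX) / h`, `[H, Y] = - Y cosh (hX) - cosh (hX) Y`, `[X, Y] = H`,
as the inverse limit of its quotients modulo `h ^ n`. -/
abbrev Uh : Type := invLim Level Level.proj

/-- The `h`-adically completed tensor product of `U_h(sl_2)` with itself over `ℂ[[h]]`. -/
abbrev UhTensor : Type :=
  invLim (fun n => Level n ⊗[R] Level n)
    (fun n => Algebra.TensorProduct.map (Level.proj n) (Level.proj n))

namespace Uh

/-- The generator `X`. -/
def X : Uh := ⟨Level.X, Level.proj_X⟩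

/-- The generator `Y`. -/
def Y : Uh := ⟨Level.Y, Level.proj_Y⟩

/-- The generator `H`. -/
def H : Uh := ⟨Level.H, Level.proj_H⟩

/-- The element `exp (h u)`. -/
def exph (u : Uh) : Uh :=
  ⟨fun n => expT n (u.1 n), fun n => by rw [Level.proj_expT, u.2 n]⟩

/-- The element `sinh (h u) / h`. -/
def sinhDiv (u : Uh) : Uh :=
  ⟨fun n => sinhDivT n (u.1 n), fun n => by rw [Level.proj_sinhDivT, u.2 n]⟩

/-- The pure tensor `a ⊗ b`. -/
def tmul (a b : Uh) : UhTensor :=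
  ⟨fun n => a.1 n ⊗ₜ[R] b.1 n, fun n => by
    rw [Algebra.TensorProduct.map_tmul, a.2 n, b.2 n]⟩

/-- The coproduct of `U_h(sl_2)`. -/
def comul : Uh →ₐ[R] UhTensor where
  toFun u := ⟨fun n => Level.comul n (u.1 n), fun n => by rw [Level.proj_comul, u.2 n]⟩
  map_one' := Subtype.ext (funext fun n => map_one (Level.comul n))
  map_mul' u v := Subtype.ext (funext fun n => map_mul (Level.comul n) (u.1 n) (v.1 n))
  map_zero' := Subtype.ext (funext fun n => map_zero (Level.comul n))
  map_add' u v := Subtype.ext (funext fun n => map_add (Level.comul n) (u.1 n) (v.1 n))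
  commutes' r := Subtype.ext (funext fun n => (Level.comul n).commutes r)

theorem H_mul_X : H * X - X * H = 2 * sinhDiv X :=
  Subtype.ext (funext fun n => (Level.sat n).zx)

theorem H_mul_Y : 2 * (H * Y - Y * H)
    = -(Y * (exph X + exph (-X))) - (exph X + exph (-X)) * Y := by
  refine Subtype.ext (funext fun n => ?_)
  change 2 * (Level.H n * Level.Y n - Level.Y n * Level.H n)
    = -(Level.Y n * (expT n (Level.X n) + expT n (-Level.X n)))
      - (expT n (Level.X n) + expT n (-Level.X n)) * Level.Y n
  rw [(Level.sat n).zy, ← two_coshT]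
  noncomm_ring

theorem X_mul_Y : X * Y - Y * X = H :=
  Subtype.ext (funext fun n => (Level.sat n).xy)

theorem comul_X : comul X = tmul X 1 + tmul 1 X :=
  Subtype.ext (funext fun n => Level.lift_X (Level.sat n).comul)

theorem comul_Y : comul Y = tmul Y (exph X) + tmul (exph (-X)) Y :=
  Subtype.ext (funext fun n => Level.lift_Y (Level.sat n).comul)

theorem comul_H : comul H = tmul H (exph X) + tmul (exph (-X)) H :=
  Subtype.ext (funext fun n => Level.lift_H (Level.sat n).comul)

/-- The antipode of `U_h(sl_2)`, as a homomorphism to the opposite algebra. -/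
def antipode : Uh →ₐ[R] Uhᵐᵒᵖ where
  toFun u := MulOpposite.op ⟨fun n => (Level.antipode n (u.1 n)).unop, fun n => by
    rw [Level.proj_antipode, u.2 n]⟩
  map_one' := congrArg MulOpposite.op <| Subtype.ext <| funext fun n =>
    congrArg MulOpposite.unop (map_one (Level.antipode n))
  map_mul' u v := congrArg MulOpposite.op <| Subtype.ext <| funext fun n =>
    congrArg MulOpposite.unop (map_mul (Level.antipode n) (u.1 n) (v.1 n))
  map_zero' := congrArg MulOpposite.op <| Subtype.ext <| funext fun n =>
    congrArg MulOpposite.unop (map_zero (Level.antipode n))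
  map_add' u v := congrArg MulOpposite.op <| Subtype.ext <| funext fun n =>
    congrArg MulOpposite.unop (map_add (Level.antipode n) (u.1 n) (v.1 n))
  commutes' r := congrArg MulOpposite.op <| Subtype.ext <| funext fun n =>
    congrArg MulOpposite.unop ((Level.antipode n).commutes r)

theorem antipode_X : antipode X = MulOpposite.op (-X) :=
  congrArg MulOpposite.op <| Subtype.ext <| funext fun n =>
    congrArg MulOpposite.unop (Level.lift_X (Level.sat n).antipode)

theorem antipode_Y : antipode Y = MulOpposite.op (-(exph X * Y * exph (-X))) :=
  congrArg MulOpposite.op <| Subtype.ext <| funext fun n =>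
    congrArg MulOpposite.unop (Level.lift_Y (Level.sat n).antipode)

theorem antipode_H : antipode H = MulOpposite.op (-(exph X * H * exph (-X))) :=
  congrArg MulOpposite.op <| Subtype.ext <| funext fun n =>
    congrArg MulOpposite.unop (Level.lift_H (Level.sat n).antipode)

/-- The left adjoint action `u ▷ v = ∑ u₍₁₎ v S(u₍₂₎)` of `U_h(sl_2)` on itself. -/
def ad (u v : Uh) : Uh :=
  ⟨fun n => Level.ad n (u.1 n) (v.1 n), fun n => by rw [Level.proj_ad, u.2 n, v.2 n]⟩

/-- On `u` with `Δ u = ∑ i, a i ⊗ b i` a finite sum, `u ▷ v = ∑ i, a i * v * S (b i)`. -/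
theorem ad_eq_sum {ι : Type*} (t : Finset ι) (a b : ι → Uh) (u v : Uh)
    (hu : comul u = ∑ i ∈ t, tmul (a i) (b i)) :
    ad u v = ∑ i ∈ t, a i * v * (antipode (b i)).unop := by
  refine Subtype.ext (funext fun n => ?_)
  have h1 : Level.comul n (u.1 n) = ∑ i ∈ t, (a i).1 n ⊗ₜ[R] (b i).1 n := by
    have := congrArg (fun w : UhTensor => w.1 n) hu
    simpa [tmul, comul] using this
  have h2 : (ad u v).1 n = Level.contract n (v.1 n) (Level.comul n (u.1 n)) := rfl
  rw [h2, h1, map_sum]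
  have h3 : (∑ i ∈ t, a i * v * (antipode (b i)).unop).1 n
      = ∑ i ∈ t, (a i).1 n * v.1 n * (Level.antipode n ((b i).1 n)).unop := by
    simp only [AddSubmonoidClass.coe_finsetSum, Finset.sum_apply]
    rfl
  rw [h3]
  simp [Level.contract]

/-- The Casimir element
`(1 / (2h)) (Y sinh (hX) + sinh (hX) Y) + (1/4) H² + (1/4) sinh (hX)²`. -/
def casimir : Uh :=
  (PowerSeries.C (1 / 2 : ℂ) : R) • (Y * sinhDiv X + sinhDiv X * Y)
    + (PowerSeries.C (1 / 4 : ℂ) : R) • H ^ 2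
    + (PowerSeries.C (1 / 4 : ℂ) : R) • (h • sinhDiv X) ^ 2

/-- `X_h = exp (hX) sinh (hX) / h`. -/
def Xh : Uh := exph X * sinhDiv X

/-- `H_h = H exp (hX)`. -/
def Hh : Uh := H * exph X

/-- `Y_h = Y exp (hX) - 2 h C`. -/
def Yh : Uh := Y * exph X - (2 * h) • casimir

/-- The space spanned by `X_h`, `H_h` and `Y_h`. -/
def qLie : Submodule R Uh := Submodule.span R {Xh, Hh, Yh}

end Uh

end JordanianSl2

end

open scoped TensorProduct

noncomputable section

namespace JordanianSl2

/-! Everything is checked modulo `h ^ n`, where the series are finite sums, and then transferred to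
the inverse limit. Modulo `h ^ n` the parameter is nilpotent, so nothing may be divided by `h`; for
this reason e = exp(hX) and s = sinh(hX)/h are kept as separate letters, linked by e² = 1 + 2hes,
which says that e - 2hs is the inverse of e. Commutation with functions of X is differentiation: [H,
f(X)] = 2s f'(X) and f(X)Y = Yf + Hf' - sf''. Together with the defining relations this gives the
rewriting system `Ordered`. Centrality of C and the action of X, H, Y on es, He, Ye
(`Ordered.casimir_commute`, `Ordered.adjoint_table`) are then comparisons of normally ordered
polynomials.

Being central, C is killed by the adjoint action of X, Y and H, so Ye and Y_h = Ye - 2hC have the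
same image under each of them. The images of Ye contain C, and the correction -2hC is what absorbs
it: this closes the span.

The adjoint action is an algebra homomorphism (`Level.adHom`), so the action of X_h = es, H_h = He
and Y_h is composed from that of the generators. On the span ad X is nilpotent, Y_h to H_h to -2X_h
to 0, so ad s acts as ad X and ad e as a quadratic polynomial in ad X, while C acts as the scalar 2.
The nine brackets follow (`brackets_of_table`), and antisymmetry is read off from them on the basis.

Independence is seen in the two-dimensional representation: there X² = 0, so the deformed relations
are the classical ones. It yields a quantitative form, `Level.pow_dvd_of_combination_eq_zero`:
coefficients are determined modulo `h ^ n`. This gives independence in the limit. It also shows that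
an element lying in the span modulo every `h ^ n` has coherent coefficients, which converge in
ℂ[[h]] (`Uh.mem_qLie_iff`), so stability passes to the limit. -/

/-! ### Normal ordering rules -/

/-- The normal ordering rules, with `y` to the left of `z` and `z` to the left of the
commuting elements `e = exp (hx)`, `s = sinh (hx) / h`, `x`. -/
structure Ordered {K A : Type*} [CommRing K] [Ring A] [Algebra K A] (h : K) (e s x y z : A) :
    Prop where
  se : s * e = e * s
  xe : x * e = e * x
  xs : x * s = s * x
  ee : e * e = 1 + (2 * h) • (e * s)
  xz : x * z = z * x - (2 : K) • s
  ez : e * z = z * e - (2 * h) • (e * s)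
  sz : s * z = z * s - (2 : K) • (e * s) + (2 * h) • (s * s)
  xy : x * y = y * x + z
  ey : e * y = y * e + h • (z * e) - h ^ 2 • (e * s)
  sy : s * y = y * s + z * e - h • (z * s) - h ^ 2 • (s * s)
  zy : z * y = y * z - (2 : K) • (y * e) + (2 * h) • (y * s) - h ^ 2 • (z * s)
    + h ^ 2 • (e * s) - h ^ 3 • (s * s)

/-- The hyperbolic cosine is eliminated as e - hs. The rule for zy comes last: its relation contains
cosh · y, which must itself be ordered by the rules for ey and sy. -/
theorem Ordered.of_eqs {K A : Type*} [CommRing K] [Ring A] [Algebra K A] {h : K} {e s x y z : A}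
    (hxs : x * s = s * x) (hxe : x * e = e * x) (hse : s * e = e * s)
    (hee : e * e = 1 + (2 * h) • (e * s))
    (hzs : z * s = s * z + 2 * s * (e - h • s))
    (hze : z * e = e * z + h • (2 * s * e))
    (hsy : s * y = y * s + z * (e - h • s) - h ^ 2 • (s * s))
    (hey : e * y = y * e + h • (z * e) - h • (h • (s * e)))
    (hzx : z * x - x * z = 2 * s)
    (hzy : z * y - y * z = -(y * (e - h • s)) - (e - h • s) * y)
    (hxy : x * y - y * x = z) : Ordered h e s x y z := by
  have sz : s * z = z * s - (2 : K) • (e * s) + (2 * h) • (s * s) := by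
    rw [hzs, mul_assoc, mul_sub, hse, mul_smul_comm, two_mul]; module
  have ey : e * y = y * e + h • (z * e) - h ^ 2 • (e * s) := by
    rw [hey, hse]; module
  have sy : s * y = y * s + z * e - h • (z * s) - h ^ 2 • (s * s) := by
    rw [hsy, mul_sub, mul_smul_comm]; module
  refine ⟨hse, hxe, hxs, hee, ?_, ?_, sz, ?_, ey, sy, ?_⟩
  · rw [sub_eq_iff_eq_add] at hzx
    rw [hzx, two_mul]; module
  · rw [hze, mul_assoc, hse, two_mul]; module
  · rw [sub_eq_iff_eq_add] at hxy
    rw [hxy]; abel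
  · rw [sub_eq_iff_eq_add] at hzy
    rw [hzy]
    simp only [mul_sub, sub_mul, smul_mul_assoc, mul_smul_comm, ey, sy]
    module

theorem smul_half {K M : Type*} [CommRing K] [AddCommGroup M] [Module K M] (c : K)
    (hc : c + c = 1) (t : K) (u v : M) : c • (u + (u - (2 * t) • v)) = u - t • v := by
  match_scalars
  · linear_combination hc
  · linear_combination -t * hc

theorem smul_half_add_sub {K M : Type*} [CommRing K] [AddCommGroup M] [Module K M] {c : K}
    (hc : c + c = 1) (a b : K) (u v p q : M) :
    c • (u + v) + a • p = c • (u + a • p + b • q + (v + a • p + b • -q)) := by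
  match_scalars
  · ring
  · ring
  · linear_combination -a * hc
  · ring

/-! ### Derivatives of sinh(hx)/h and the commutation rules they give -/

section Relations

variable {A : Type*} [Ring A] [Algebra R A] {n : ℕ} {x y z : A}

/-- The derivative of `sinh (hx) / h` is `cosh (hx)`. -/
theorem sum_sinhDiv_shift (hn : algebraMap R A (h ^ n) = 0) (a : A) :
    ∑ k ∈ Finset.range n, (PowerSeries.monomial (2 * k) (((2 * k + 1).factorial : ℂ)⁻¹) : R)
      • ((2 * k + 1) • a ^ (2 * k)) = coshT n a := by
  have key : ∀ m : ℕ, ∑ k ∈ Finset.range m,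
      (PowerSeries.monomial (2 * k) (((2 * k + 1).factorial : ℂ)⁻¹) : R)
      • ((2 * k + 1) • a ^ (2 * k)) = coshT (2 * m) a := by
    intro m
    induction m with
    | zero => simp [coshT, expT]
    | succ m ih =>
      rw [Finset.sum_range_succ, ih, coshT, coshT, expT, expT, expT, expT,
        show 2 * (m + 1) = 2 * m + 1 + 1 by ring]
      simp only [Finset.sum_range_succ]
      rw [Even.neg_pow ⟨m, by ring⟩, Odd.neg_pow ⟨m, rfl⟩]
      -- (2m+1)/(2m+1)! = 1/(2m)!. Passing from 2m to 2m+2 adds an even and an odd term to each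
      -- exponential; in the half sum the even ones add up to this term and the odd ones cancel.
      have e1 : (PowerSeries.monomial (2 * m) (((2 * m + 1).factorial : ℂ)⁻¹) : R)
          • ((2 * m + 1) • a ^ (2 * m))
          = (PowerSeries.monomial (2 * m) (((2 * m).factorial : ℂ)⁻¹) : R) • a ^ (2 * m) := by
        rw [← Nat.cast_smul_eq_nsmul R, smul_smul, monomial_eq, monomial_eq,
          Nat.factorial_succ]
        congr 1
        have : ((2 * m + 1 : ℕ) : R) = PowerSeries.C ((2 * m + 1 : ℕ) : ℂ) := by rw [map_natCast]
        rw [this, mul_right_comm, ← map_mul]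
        congr 2
        have h1 : 2 * (m : ℂ) + 1 ≠ 0 := by exact_mod_cast Nat.succ_ne_zero (2 * m)
        have h2 : ((2 * m).factorial : ℂ) ≠ 0 := by exact_mod_cast Nat.factorial_ne_zero _
        push_cast
        field_simp
      rw [e1]
      exact smul_half_add_sub C_half_add _ _ _ _ _ _
  rw [key, coshT_eq_of_le hn (by omega)]

/-- The second derivative of `sinh (hx) / h` is `h ^ 2` times itself. -/
theorem sum_sinhDiv_shift_two (hn : algebraMap R A (h ^ n) = 0) (a : A) :
    ∑ k ∈ Finset.range n, (PowerSeries.monomial (2 * k) (((2 * k + 1).factorial : ℂ)⁻¹) : R)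
      • ((2 * k + 1) • ((2 * k) • a ^ (2 * k - 1))) = h ^ 2 • sinhDivT n a := by
  rcases n with _ | n
  · simp [sinhDivT]
  -- The term k = 0 on the left has second derivative zero. The top term on the right, once
  -- multiplied by h², has order 2n + 2 and vanishes. The remaining terms match after a shift by
  -- one.
  rw [Finset.sum_range_succ', sinhDivT, Finset.sum_range_succ _ n, smul_add]
  have e3 : ∀ (k : ℕ) (c : ℂ), (PowerSeries.monomial (k + 2) c : R)
      = h ^ 2 * PowerSeries.monomial k c := by
    intro k c
    rw [monomial_eq, monomial_eq]; ring
  rw [smul_smul (h ^ 2), ← e3, smul_eq_zero_of_pow hn (m := 2 * n + 2) (by omega), Finset.smul_sum]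
  simp only [mul_zero, zero_smul, smul_zero]
  congr 1
  refine Finset.sum_congr rfl fun k _ => ?_
  rw [show 2 * (k + 1) - 1 = 2 * k + 1 by omega, smul_smul (h ^ 2), ← e3, smul_smul,
    ← Nat.cast_smul_eq_nsmul R, smul_smul, show 2 * (k + 1) = 2 * k + 1 + 1 by ring]
  congr 1
  rw [monomial_eq, monomial_eq, Nat.factorial_succ, Nat.factorial_succ (2 * k + 1)]
  have : (((2 * k + 1 + 1 + 1) * (2 * k + 1 + 1) : ℕ) : R)
      = PowerSeries.C (((2 * k + 1 + 1 + 1) * (2 * k + 1 + 1) : ℕ) : ℂ) := by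
    rw [map_natCast]
  rw [this, mul_right_comm, ← map_mul]
  congr 2
  have h1 : 2 * ((k : ℂ) + 1) + 1 ≠ 0 := by exact_mod_cast Nat.succ_ne_zero (2 * (k + 1))
  have h2 : 2 * (k : ℂ) + 1 + 1 ≠ 0 := by exact_mod_cast Nat.succ_ne_zero (2 * k + 1)
  have h3 : ((2 * k + 1).factorial : ℂ) ≠ 0 := by exact_mod_cast Nat.factorial_ne_zero _
  push_cast
  field_simp
  ring

/-- By `Sat.z_pow`, commutation with z acts on polynomials in x as the derivation 2s d/dx; the
derivative of s is the cosine. -/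
theorem Sat.z_sinhDiv (hs : Sat n x y z) :
    z * sinhDivT n x = sinhDivT n x * z + 2 * sinhDivT n x * coshT n x := by
  have hk := hs.z_pow
  rw [← sum_sinhDiv_shift hs.pow]
  -- The series occurs both as the function being differentiated and as the coefficient of the
  -- derivation; the name S keeps the coefficient folded while the former is expanded.
  generalize hS : sinhDivT n x = S at *
  have h1 : z * S = ∑ k ∈ Finset.range n,
      (PowerSeries.monomial (2 * k) (((2 * k + 1).factorial : ℂ)⁻¹) : R)
        • (z * x ^ (2 * k + 1)) := by
    rw [← hS, sinhDivT, Finset.mul_sum]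
    simp only [mul_smul_comm]
  have h2 : S * z = ∑ k ∈ Finset.range n,
      (PowerSeries.monomial (2 * k) (((2 * k + 1).factorial : ℂ)⁻¹) : R)
        • (x ^ (2 * k + 1) * z) := by
    rw [← hS, sinhDivT, Finset.sum_mul]
    simp only [smul_mul_assoc]
  rw [h1, h2, Finset.mul_sum, ← Finset.sum_add_distrib]
  refine Finset.sum_congr rfl fun k _ => ?_
  rw [hk, smul_add, Nat.add_sub_cancel]
  simp only [mul_smul_comm]

/-- The rule f(x)y = yf + zf' - sf'', known on powers of x by `Sat.pow_y`, is summed over the series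
of s, for which f' is the cosine and f'' = h²s. -/
theorem Sat.sinhDiv_y (hs : Sat n x y z) :
    sinhDivT n x * y = y * sinhDivT n x + z * coshT n x
      - h ^ 2 • (sinhDivT n x * sinhDivT n x) := by
  have hk := hs.pow_y
  rw [← mul_smul_comm, ← sum_sinhDiv_shift_two hs.pow, ← sum_sinhDiv_shift hs.pow]
  generalize hS : sinhDivT n x = S at *
  have h1 : S * y = ∑ k ∈ Finset.range n,
      (PowerSeries.monomial (2 * k) (((2 * k + 1).factorial : ℂ)⁻¹) : R)
        • (x ^ (2 * k + 1) * y) := by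
    rw [← hS, sinhDivT, Finset.sum_mul]
    simp only [smul_mul_assoc]
  have h2 : y * S = ∑ k ∈ Finset.range n,
      (PowerSeries.monomial (2 * k) (((2 * k + 1).factorial : ℂ)⁻¹) : R)
        • (y * x ^ (2 * k + 1)) := by
    rw [← hS, sinhDivT, Finset.mul_sum]
    simp only [mul_smul_comm]
  rw [h1, h2, Finset.mul_sum, Finset.mul_sum, ← Finset.sum_add_distrib,
    ← Finset.sum_sub_distrib]
  refine Finset.sum_congr rfl fun k _ => ?_
  rw [hk, smul_sub, smul_add, Nat.add_sub_cancel]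
  simp only [mul_smul_comm]

theorem expT_neg_eq (hn : algebraMap R A (h ^ n) = 0) (a : A) :
    expT n (-a) = expT n a - (2 * h) • sinhDivT n a := by
  rw [mul_smul, ofNat_smul_eq_nsmul, two_nsmul, ← smul_add, ← two_mul, two_h_sinhDivT hn,
    sub_sub_cancel]

theorem coshT_eq (hn : algebraMap R A (h ^ n) = 0) (a : A) :
    coshT n a = expT n a - h • sinhDivT n a := by
  rw [coshT, expT_neg_eq hn, smul_half _ C_half_add]

theorem Sat.ordered (hs : Sat n x y z) : Ordered h (expT n x) (sinhDivT n x) x y z := by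
  have hxs : Commute x (sinhDivT n x) := sinhDivT_commute (Commute.refl x) n
  have hxe : Commute x (expT n x) := expT_commute (Commute.refl x) n
  have hse : Commute (sinhDivT n x) (expT n x) := expT_commute hxs.symm n
  have hc := coshT_eq hs.pow x
  have hee : expT n x * expT n x = 1 + (2 * h) • (expT n x * sinhDivT n x) := by
    have h1 := expT_mul_neg hs.pow x
    rw [expT_neg_eq hs.pow, mul_sub, mul_smul_comm] at h1
    rw [← h1]; abel
  have hzs := hs.z_sinhDiv
  have hze := hs.z_exp
  have hsy := hs.sinhDiv_y
  have hey := hs.exp_y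
  have hzx := hs.zx
  have hzy := hs.zy
  have hxy := hs.xy
  rw [hc] at hzs hsy hzy
  exact Ordered.of_eqs hxs.eq hxe.eq hse.eq hee hzs hze hsy hey hzx hzy hxy

end Relations

/-! ### Centrality of the Casimir element and the adjoint action, by normal ordering -/

namespace Ordered

variable {K A : Type*} [CommRing K] [Ring A] [Algebra K A] {h : K} {e s x y z : A}

/-- Four times the Casimir element. -/
def casimir (h : K) (s y z : A) : A :=
  (2 : K) • (y * s + s * y) + z * z + h ^ 2 • (s * s)

-- The two products have the same normal form. Working with 4C avoids fractions, so the computation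
-- is valid over any commutative ring.
set_option linter.unusedSimpArgs false in
theorem casimir_commute (o : Ordered h e s x y z) :
    Commute (casimir h s y z) x ∧ Commute (casimir h s y z) y ∧ Commute (casimir h s y z) z ∧
      Commute (casimir h s y z) e ∧ Commute (casimir h s y z) s := by
  -- Words are associated to the right, so a rule for a product ab does not match inside abw. Each
  -- rule is therefore also supplied multiplied on the right by an arbitrary w.
  have key : ∀ {a b : A}, a = b → ∀ w, a * w = b * w := fun h w => h ▸ rfl
  have r1 := key o.se
  have r2 := key o.xe
  have r3 := key o.xs
  have r4 := key o.ee
  have r5 := key o.xz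
  have r6 := key o.ez
  have r7 := key o.sz
  have r8 := key o.xy
  have r9 := key o.ey
  have r10 := key o.sy
  have r11 := key o.zy
  simp only [mul_assoc, sub_mul, add_mul, smul_mul_assoc, one_mul]
    at r1 r2 r3 r4 r5 r6 r7 r8 r9 r10 r11
  simp only [Commute, SemiconjBy, casimir]
  refine ⟨?_, ?_, ?_, ?_, ?_⟩ <;>
  · simp only [mul_assoc, sub_mul, add_mul, mul_add, mul_sub, smul_mul_assoc, mul_smul_comm,
      smul_add, smul_sub, one_mul, mul_one, o.se, o.xe, o.xs, o.ee, o.xz, o.ez, o.sz, o.xy,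
      o.ey, o.sy, o.zy, r1, r2, r3, r4, r5, r6, r7, r8, r9, r10, r11]
    module

set_option maxHeartbeats 2000000 in
set_option linter.unusedSimpArgs false in
/-- The adjoint action of `x`, `z` and `y` on `e * s`, `z * e` and `y * e`, where
`e - (2 * h) • s` is the inverse of `e`. -/
theorem adjoint_table (o : Ordered h e s x y z) :
    (x * (e * s) - e * s * x = 0 ∧
      x * (z * e) - z * e * x = -((2 : K) • (e * s)) ∧
      x * (y * e) - y * e * x = z * e) ∧
    (z * (e * s) * (e - (2 * h) • s)
        - (e - (2 * h) • s) * (e * s) * e * z * (e - (2 * h) • s) = (2 : K) • (e * s) ∧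
      z * (z * e) * (e - (2 * h) • s)
        - (e - (2 * h) • s) * (z * e) * e * z * (e - (2 * h) • s) = (4 * h) • (e * s) ∧
      z * (y * e) * (e - (2 * h) • s)
        - (e - (2 * h) • s) * (y * e) * e * z * (e - (2 * h) • s)
        = -((2 : K) • (y * e)) + h • casimir h s y z - (2 * h) • (z * e) - h ^ 2 • (e * s)) ∧
    (y * (e * s) * (e - (2 * h) • s)
        - (e - (2 * h) • s) * (e * s) * e * y * (e - (2 * h) • s)
        = -(z * e) + (2 * h) • (e * s) ∧
      y * (z * e) * (e - (2 * h) • s)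
        - (e - (2 * h) • s) * (z * e) * e * y * (e - (2 * h) • s)
        = (2 : K) • (y * e) - h • casimir h s y z + (3 * h ^ 2) • (e * s) ∧
      y * (y * e) * (e - (2 * h) • s)
        - (e - (2 * h) • s) * (y * e) * e * y * (e - (2 * h) • s)
        = -((2 * h) • (y * e)) + h ^ 2 • casimir h s y z - h ^ 2 • (z * e)
          - h ^ 3 • (e * s)) := by
  have key : ∀ {a b : A}, a = b → ∀ w, a * w = b * w := fun h w => h ▸ rfl
  have r1 := key o.se
  have r2 := key o.xe
  have r3 := key o.xs
  have r4 := key o.ee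
  have r5 := key o.xz
  have r6 := key o.ez
  have r7 := key o.sz
  have r8 := key o.xy
  have r9 := key o.ey
  have r10 := key o.sy
  have r11 := key o.zy
  simp only [mul_assoc, sub_mul, add_mul, smul_mul_assoc, one_mul]
    at r1 r2 r3 r4 r5 r6 r7 r8 r9 r10 r11
  simp only [casimir]
  refine ⟨⟨?_, ?_, ?_⟩, ⟨?_, ?_, ?_⟩, ?_, ?_, ?_⟩ <;>
  · simp only [mul_assoc, sub_mul, add_mul, mul_add, mul_sub, smul_mul_assoc, mul_smul_comm,
      smul_add, smul_sub, one_mul, mul_one, o.se, o.xe, o.xs, o.ee, o.xz, o.ez, o.sz, o.xy,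
      o.ey, o.sy, o.zy, r1, r2, r3, r4, r5, r6, r7, r8, r9, r10, r11]
    module

end Ordered

/-! ### The adjoint action of the generators modulo `h ^ n` -/

namespace Level

variable {n : ℕ}

@[elab_as_elim]
theorem induction {p : Level n → Prop} (alg : ∀ r, p (algebraMap R _ r)) (hX : p (X n))
    (hY : p (Y n)) (hH : p (H n)) (add : ∀ u v, p u → p v → p (u + v))
    (mul : ∀ u v, p u → p v → p (u * v)) (u : Level n) : p u := by
  obtain ⟨w, rfl⟩ := RingQuot.mkAlgHom_surjective R (Rel n) u
  change p (mk n w)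
  induction w using FreeAlgebra.induction with
  | grade0 r => rw [AlgHom.commutes]; exact alg r
  | grade1 g => cases g; exacts [hX, hY, hH]
  | mul a b ha hb => rw [map_mul]; exact mul _ _ ha hb
  | add a b ha hb => rw [map_add]; exact add _ _ ha hb

theorem ordered (n : ℕ) : Ordered h (expT n (X n)) (sinhDivT n (X n)) (X n) (Y n) (H n) :=
  (Level.sat n).ordered

/-- The antipode reverses products, so (aa') b S(cc') = a (a' b S(c')) S(c). This is what makes the
adjoint action multiplicative. -/
theorem contract_mul (b : Level n) (u v : Level n ⊗[R] Level n) :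
    contract n b (u * v) = contract n (contract n b v) u := by
  induction u using TensorProduct.induction_on with
  | zero => simp
  | add u u' hu hu' => rw [add_mul, map_add, map_add, hu, hu']
  | tmul a c =>
    induction v using TensorProduct.induction_on with
    | zero => simp [contract]
    | add v v' hv hv' =>
      rw [mul_add, map_add, map_add, hv, hv']
      simp [contract, mul_add, add_mul]
    | tmul a' c' => simp [contract, mul_assoc]

/-- The left adjoint action as an algebra homomorphism. -/
def adHom (n : ℕ) : Level n →ₐ[R] Module.End R (Level n) :=
  AlgHom.ofLinearMap
    { toFun u :=
        { toFun := fun v => ad n u v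
          map_add' := fun v w => by
            unfold ad
            induction comul n u using TensorProduct.induction_on with
            | zero => simp
            | add a b ha hb => simp only [map_add, ha, hb]; abel
            | tmul a c => simp [contract, mul_add, add_mul]
          map_smul' := fun r v => by
            unfold ad
            induction comul n u using TensorProduct.induction_on with
            | zero => simp
            | add a b ha hb => simp only [map_add, ha, hb, smul_add]
            | tmul a c => simp [contract] }
      map_add' := fun u v => LinearMap.ext fun w => by simp [ad]
      map_smul' := fun r u => LinearMap.ext fun w => by simp [ad] }
    (LinearMap.ext fun w => by simp [ad, contract, Algebra.TensorProduct.one_def])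
    (fun u v => LinearMap.ext fun w => by simp [ad, contract_mul])

theorem adHom_apply (u v : Level n) : adHom n u v = ad n u v := rfl

theorem antipode_expT (n : ℕ) : (antipode n (expT n (X n))).unop = expT n (-X n) := by
  rw [map_expT, antipode, lift_X, expT, expT]
  simp [Finset.unop_sum]

theorem ad_X (v : Level n) : ad n (X n) v = X n * v - v * X n := by
  simp [ad, comul, contract, antipode, sub_eq_add_neg]

/-- Here S(exp(hX)) = exp(-hX), and the minus sign of the second term is that of S(Y). -/
theorem ad_Y (v : Level n) : ad n (Y n) v = Y n * v * expT n (-X n)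
    - expT n (-X n) * v * expT n (X n) * Y n * expT n (-X n) := by
  rw [ad, comul, lift_Y, map_add]
  simp [contract, antipode_expT, sub_eq_add_neg]
  simp [antipode, mul_assoc]

theorem ad_H (v : Level n) : ad n (H n) v = H n * v * expT n (-X n)
    - expT n (-X n) * v * expT n (X n) * H n * expT n (-X n) := by
  rw [ad, comul, lift_H, map_add]
  simp [contract, antipode_expT, sub_eq_add_neg]
  simp [antipode, mul_assoc]

/-- The Casimir element modulo `h ^ n`. -/
def cas (n : ℕ) : Level n := Uh.casimir.1 n

/-- `X_h` modulo `h ^ n`. -/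
def Xh (n : ℕ) : Level n := expT n (X n) * sinhDivT n (X n)

/-- `H_h` modulo `h ^ n`. -/
def Hh (n : ℕ) : Level n := H n * expT n (X n)

/-- `Y_h` modulo `h ^ n`. -/
def Yh (n : ℕ) : Level n := Y n * expT n (X n) - (2 * h) • cas n

theorem cas_eq_aux {K A : Type*} [CommRing K] [Ring A] [Algebra K A] {a b h : K} (ha : 2 * a = 1)
    (hb : 4 * b = 1) (s y z : A) :
    a • (y * s + s * y) + b • z ^ 2 + b • (h • s) ^ 2 = b • Ordered.casimir h s y z := by
  -- The scalars a and b are 1/2 and 1/4; after this substitution b is a common factor.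
  have : a = b * 2 := by linear_combination 2 * b * ha - a * hb
  subst this
  rw [smul_pow, pow_two z, pow_two s, Ordered.casimir]
  module

theorem two_C_half : 2 * (PowerSeries.C (1 / 2 : ℂ) : R) = 1 := by
  rw [two_mul, C_half_add]

theorem four_C_quarter : 4 * (PowerSeries.C (1 / 4 : ℂ) : R) = 1 := by
  rw [show (4 : R) = PowerSeries.C (4 : ℂ) from (map_ofNat PowerSeries.C 4).symm, ← map_mul]
  norm_num

theorem cas_eq : cas n = (PowerSeries.C (1 / 4 : ℂ) : R) •
    Ordered.casimir h (sinhDivT n (X n)) (Y n) (H n) :=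
  cas_eq_aux two_C_half four_C_quarter _ _ _

theorem casimir_eq : Ordered.casimir h (sinhDivT n (X n)) (Y n) (H n) = (4 : R) • cas n := by
  rw [cas_eq, smul_smul, four_C_quarter, one_smul]

theorem commute_of_generators {c : Level n} (hX : Commute c (X n)) (hY : Commute c (Y n))
    (hH : Commute c (H n)) (u : Level n) : Commute c u := by
  induction u using Level.induction with
  | alg r => exact Algebra.commutes' r c |>.symm
  | hX => exact hX
  | hY => exact hY
  | hH => exact hH
  | add u v hu hv => exact hu.add_right hv
  | mul u v hu hv => exact hu.mul_right hv

theorem cas_commute (u : Level n) : Commute (cas n) u := by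
  obtain ⟨h1, h2, h3, -, -⟩ := (ordered n).casimir_commute
  rw [cas_eq]
  exact (commute_of_generators h1 h2 h3 u).smul_left _

theorem ad_X_cas : ad n (X n) (cas n) = 0 := by
  rw [ad_X, (cas_commute _).eq, sub_self]

theorem ad_Y_cas : ad n (Y n) (cas n) = 0 := by
  rw [ad_Y, ← (cas_commute (Y n)).eq, ← (cas_commute (expT n (-X n))).eq,
    mul_assoc (cas n) _ (expT n (X n)), expT_neg_mul (sat n).pow, mul_one, sub_self]

theorem ad_H_cas : ad n (H n) (cas n) = 0 := by
  rw [ad_H, ← (cas_commute (H n)).eq, ← (cas_commute (expT n (-X n))).eq,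
    mul_assoc (cas n) _ (expT n (X n)), expT_neg_mul (sat n).pow, mul_one, sub_self]

/-- Reduces the action on Y_h to the action on Ye, which `Ordered.adjoint_table` computes. -/
theorem ad_Yh {u : Level n} (hu : ad n u (cas n) = 0) :
    ad n u (Yh n) = ad n u (Y n * expT n (X n)) := by
  rw [Yh, ← adHom_apply, map_sub, map_smul, adHom_apply, adHom_apply, hu, smul_zero, sub_zero]

theorem Y_mul_expT : Y n * expT n (X n) = Yh n + (2 * h) • cas n := by
  rw [Yh, sub_add_cancel]

theorem table_X : ad n (X n) (Xh n) = 0 ∧ ad n (X n) (Hh n) = -((2 : R) • Xh n) ∧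
    ad n (X n) (Yh n) = Hh n := by
  rw [ad_Yh ad_X_cas]
  simp only [ad_X]
  exact (ordered n).adjoint_table.1

/-- Substituting Ye = Y_h + 2hC in the three rows where 4C occurs makes every multiple of C cancel.
Here x, y, z, c stand for X_h, Y_h, H_h, C. -/
theorem module_aux {K M : Type*} [CommRing K] [AddCommGroup M] [Module K M] (h : K)
    (x y z c : M) :
    -((2 : K) • (y + (2 * h) • c)) + h • ((4 : K) • c) - (2 * h) • z - h ^ 2 • x
      = -((2 : K) • y) - (2 * h) • z - h ^ 2 • x ∧
    (2 : K) • (y + (2 * h) • c) - h • ((4 : K) • c) + (3 * h ^ 2) • x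
      = (2 : K) • y + (3 * h ^ 2) • x ∧
    -((2 * h) • (y + (2 * h) • c)) + h ^ 2 • ((4 : K) • c) - h ^ 2 • z - h ^ 3 • x
      = -((2 * h) • y) - h ^ 2 • z - h ^ 3 • x := by
  refine ⟨?_, ?_, ?_⟩ <;> module

theorem table_H : ad n (H n) (Xh n) = (2 : R) • Xh n ∧ ad n (H n) (Hh n) = (4 * h) • Xh n ∧
    ad n (H n) (Yh n) = -((2 : R) • Yh n) - (2 * h) • Hh n - h ^ 2 • Xh n := by
  rw [ad_Yh ad_H_cas]
  simp only [ad_H, expT_neg_eq (sat n).pow]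
  obtain ⟨h1, h2, h3⟩ := (ordered n).adjoint_table.2.1
  refine ⟨h1, h2, h3.trans ?_⟩
  rw [casimir_eq, Y_mul_expT]
  exact (module_aux _ _ _ _ _).1

theorem table_Y : ad n (Y n) (Xh n) = -Hh n + (2 * h) • Xh n ∧
    ad n (Y n) (Hh n) = (2 : R) • Yh n + (3 * h ^ 2) • Xh n ∧
    ad n (Y n) (Yh n) = -((2 * h) • Yh n) - h ^ 2 • Hh n - h ^ 3 • Xh n := by
  rw [ad_Yh ad_Y_cas]
  simp only [ad_Y, expT_neg_eq (sat n).pow]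
  obtain ⟨h1, h2, h3⟩ := (ordered n).adjoint_table.2.2
  refine ⟨h1, h2.trans ?_, h3.trans ?_⟩
  · rw [casimir_eq, Y_mul_expT]
    -- The second identity does not contain z, so unification cannot find it; 0 is an arbitrary
    -- value.
    exact (module_aux _ _ (Yh n) 0 (cas n)).2.1
  · rw [casimir_eq, Y_mul_expT]
    exact (module_aux _ _ _ _ _).2.2

end Level

/-! ### Series in a nilpotent operator, and the brackets on the span -/

section Nilpotent

variable {A M : Type*} [Ring A] [Algebra R A] [AddCommGroup M] [Module R M] [Module A M]
  [IsScalarTower R A M] {n : ℕ}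

theorem expT_smul_of_cube (hn : algebraMap R A (h ^ n) = 0) (a : A) (v : M)
    (hv : a • a • a • v = 0) :
    expT n a • v = v + h • a • v + (PowerSeries.C (1 / 2 : ℂ) * h ^ 2 : R) • a • a • v := by
  -- The truncation is raised to n + 3 so that the terms of degree 0, 1, 2 are present for every n;
  -- all later terms contain a³.
  rw [← expT_eq_of_le hn (show n ≤ n + 3 by omega), expT, Finset.sum_smul,
    Finset.sum_range_succ', Finset.sum_range_succ', Finset.sum_range_succ', Finset.sum_eq_zero]
  · simp [monomial_eq, smul_assoc, mul_smul, pow_two]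
    abel
  · intro k _
    simp [pow_succ, mul_smul, hv]

theorem sinhDivT_smul_of_cube (hn : algebraMap R A (h ^ n) = 0) (a : A) (v : M)
    (hv : a • a • a • v = 0) : sinhDivT n a • v = a • v := by
  rw [← sinhDivT_eq_of_le hn (show n ≤ n + 1 by omega), sinhDivT, Finset.sum_smul,
    Finset.sum_range_succ', Finset.sum_eq_zero]
  · simp
  · intro k _
    rw [show 2 * (k + 1) + 1 = 2 * k + 3 by ring]
    simp [pow_succ, mul_smul, hv]

end Nilpotent

set_option linter.unusedSimpArgs false in
/-- The brackets, from the action of the generators. -/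
theorem brackets_of_table {K M : Type*} [CommRing K] [AddCommGroup M] [Module K M] {h a : K}
    (ha : 2 * a = 1) {X Y H E S : M →ₗ[K] M} {p q r : M}
    (hE : ∀ v, X (X (X v)) = 0 → E v = v + h • X v + (a * h ^ 2) • X (X v))
    (hS : ∀ v, X (X (X v)) = 0 → S v = X v)
    (hX : X p = 0 ∧ X q = -((2 : K) • p) ∧ X r = q)
    (hH : H p = (2 : K) • p ∧ H q = (4 * h) • p ∧
      H r = -((2 : K) • r) - (2 * h) • q - h ^ 2 • p)
    (hY : Y p = -q + (2 * h) • p ∧ Y q = (2 : K) • r + (3 * h ^ 2) • p ∧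
      Y r = -((2 * h) • r) - h ^ 2 • q - h ^ 3 • p) :
    (E (S p) = 0 ∧ E (S q) = -((2 : K) • p) ∧ E (S r) = q - (2 * h) • p) ∧
    (H (E p) = (2 : K) • p ∧ H (E q) = 0 ∧
      H (E r) = -((2 : K) • r) - (2 * h) • q + h ^ 2 • p) ∧
    (Y (E p) - (4 * h) • p = -q - (2 * h) • p ∧
      Y (E q) - (4 * h) • q = (2 : K) • r - (2 * h) • q - h ^ 2 • p ∧
      Y (E r) - (4 * h) • r = -((4 * h) • r)) ∧
    ∀ v, v = p ∨ v = q ∨ v = r →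
      (2 : K) • (Y (S v) + S (Y v)) + H (H v) + h ^ 2 • S (S v) = (8 : K) • v := by
  obtain ⟨x1, x2, x3⟩ := hX
  obtain ⟨z1, z2, z3⟩ := hH
  obtain ⟨y1, y2, y3⟩ := hY
  -- The chain r, q, -2p, 0 under X shows that X³ vanishes on p, q and r, so `hE` and `hS` apply to
  -- each of them.
  have sp : S p = 0 := by rw [hS, x1]; simp [x1]
  have sq : S q = -((2 : K) • p) := by rw [hS, x2]; simp [x1, x2]
  have sr : S r = q := by rw [hS, x3]; simp [x1, x2, x3]
  have ep : E p = p := by rw [hE] <;> simp [x1]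
  have eq : E q = q - (2 * h) • p := by
    rw [hE] <;> simp only [x1, x2, map_neg, map_smul, smul_zero, neg_zero, map_zero]
    module
  have er : E r = r + h • q - h ^ 2 • p := by
    rw [hE] <;> simp only [x1, x2, x3, map_neg, map_smul, smul_zero, neg_zero]
    match_scalars
    · ring
    · ring
    · linear_combination -h ^ 2 * ha
  simp only [sp, sq, sr, ep, eq, er, map_neg, map_smul, map_add, map_sub, map_zero, z1, z2, z3,
    y1, y2, y3]
  refine ⟨⟨trivial, trivial, trivial⟩, ⟨trivial, ?_, ?_⟩, ⟨?_, ?_, ?_⟩, ?_⟩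
  · module
  · module
  · module
  · module
  · module
  · rintro v (rfl | rfl | rfl) <;>
    · simp only [sp, sq, sr, y1, y2, y3, z1, z2, z3, map_neg, map_smul, map_add, map_sub, map_zero]
      module

/-! ### The brackets modulo `h ^ n` -/

namespace Level

variable {n : ℕ}

theorem algebraMap_end (n : ℕ) : algebraMap R (Module.End R (Level n)) (h ^ n) = 0 := by
  rw [← (adHom n).commutes, (sat n).pow, map_zero]

theorem adHom_expT (v : Level n)
    (hv : adHom n (X n) (adHom n (X n) (adHom n (X n) v)) = 0) :
    adHom n (expT n (X n)) v = v + h • adHom n (X n) v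
      + (PowerSeries.C (1 / 2 : ℂ) * h ^ 2 : R) • adHom n (X n) (adHom n (X n) v) := by
  rw [map_expT]
  exact expT_smul_of_cube (algebraMap_end n) _ _ hv

theorem adHom_sinhDivT (v : Level n)
    (hv : adHom n (X n) (adHom n (X n) (adHom n (X n) v)) = 0) :
    adHom n (sinhDivT n (X n)) v = adHom n (X n) v := by
  rw [map_sinhDivT]
  exact sinhDivT_smul_of_cube (algebraMap_end n) _ _ hv

theorem brackets_of_generators (n : ℕ) :
    (adHom n (expT n (X n)) (adHom n (sinhDivT n (X n)) (Xh n)) = 0 ∧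
      adHom n (expT n (X n)) (adHom n (sinhDivT n (X n)) (Hh n)) = -((2 : R) • Xh n) ∧
      adHom n (expT n (X n)) (adHom n (sinhDivT n (X n)) (Yh n)) = Hh n - (2 * h) • Xh n) ∧
    (adHom n (H n) (adHom n (expT n (X n)) (Xh n)) = (2 : R) • Xh n ∧
      adHom n (H n) (adHom n (expT n (X n)) (Hh n)) = 0 ∧
      adHom n (H n) (adHom n (expT n (X n)) (Yh n))
        = -((2 : R) • Yh n) - (2 * h) • Hh n + h ^ 2 • Xh n) ∧
    (adHom n (Y n) (adHom n (expT n (X n)) (Xh n)) - (4 * h) • Xh n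
        = -Hh n - (2 * h) • Xh n ∧
      adHom n (Y n) (adHom n (expT n (X n)) (Hh n)) - (4 * h) • Hh n
        = (2 : R) • Yh n - (2 * h) • Hh n - h ^ 2 • Xh n ∧
      adHom n (Y n) (adHom n (expT n (X n)) (Yh n)) - (4 * h) • Yh n = -((4 * h) • Yh n)) ∧
    ∀ v, v = Xh n ∨ v = Hh n ∨ v = Yh n →
      (2 : R) • (adHom n (Y n) (adHom n (sinhDivT n (X n)) v)
          + adHom n (sinhDivT n (X n)) (adHom n (Y n) v))
        + adHom n (H n) (adHom n (H n) v)
        + h ^ 2 • adHom n (sinhDivT n (X n)) (adHom n (sinhDivT n (X n)) v) = (8 : R) • v :=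
  brackets_of_table two_C_half adHom_expT adHom_sinhDivT table_X table_H table_Y

theorem brackets_Xh : ad n (Xh n) (Xh n) = 0 ∧ ad n (Xh n) (Hh n) = -((2 : R) • Xh n) ∧
    ad n (Xh n) (Yh n) = Hh n - (2 * h) • Xh n := by
  have e (v : Level n) : ad n (Xh n) v
      = adHom n (expT n (X n)) (adHom n (sinhDivT n (X n)) v) := by
    rw [← adHom_apply, Xh, map_mul, Module.End.mul_apply]
  simpa only [e] using (brackets_of_generators n).1

theorem brackets_Hh : ad n (Hh n) (Xh n) = (2 : R) • Xh n ∧ ad n (Hh n) (Hh n) = 0 ∧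
    ad n (Hh n) (Yh n) = -((2 : R) • Yh n) - (2 * h) • Hh n + h ^ 2 • Xh n := by
  have e (v : Level n) : ad n (Hh n) v = adHom n (H n) (adHom n (expT n (X n)) v) := by
    rw [← adHom_apply, Hh, map_mul, Module.End.mul_apply]
  simpa only [e] using (brackets_of_generators n).2.1

/-- The scalar is the classical value j(j + 1) with j = 1 for the adjoint representation; in the
computation it appears as 8/4, since 4C acts as 8. -/
theorem ad_cas {v : Level n} (hv : v = Xh n ∨ v = Hh n ∨ v = Yh n) :
    ad n (cas n) v = (2 : R) • v := by
  have h8 := (brackets_of_generators n).2.2.2 v hv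
  rw [← adHom_apply, cas_eq, Ordered.casimir]
  simp only [map_smul, map_add, map_mul, LinearMap.smul_apply, LinearMap.add_apply,
    Module.End.mul_apply]
  rw [h8, smul_smul]
  congr 1
  linear_combination 2 * four_C_quarter

/-- The term -4h is -2h times the scalar 2 by which the Casimir element acts. -/
theorem ad_Yh_left {v : Level n} (hv : v = Xh n ∨ v = Hh n ∨ v = Yh n) :
    ad n (Yh n) v = adHom n (Y n) (adHom n (expT n (X n)) v) - (4 * h) • v := by
  rw [← adHom_apply, Yh, map_sub, map_smul, map_mul, LinearMap.sub_apply, Module.End.mul_apply,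
    LinearMap.smul_apply, adHom_apply (cas n), ad_cas hv, smul_smul]
  congr 2
  ring

theorem brackets_Yh : ad n (Yh n) (Xh n) = -Hh n - (2 * h) • Xh n ∧
    ad n (Yh n) (Hh n) = (2 : R) • Yh n - (2 * h) • Hh n - h ^ 2 • Xh n ∧
    ad n (Yh n) (Yh n) = -((4 * h) • Yh n) := by
  rw [ad_Yh_left (.inl rfl), ad_Yh_left (.inr (.inl rfl)), ad_Yh_left (.inr (.inr rfl))]
  exact (brackets_of_generators n).2.2.1

/-! ### Independence modulo `h ^ n` -/

/-- The ring `ℂ[[h]] / h ^ n`. -/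
abbrev Trunc (n : ℕ) : Type := R ⧸ Ideal.span {(h ^ n : R)}

/-- When x² = 0 the series stop: sinh(hx)/h = x and cosh(hx) = 1. The deformed relations become
those of classical sl₂, so its two-dimensional representation needs no deformation. -/
theorem sat_of_sq_eq_zero {A : Type*} [Ring A] [Algebra R A] (hn : algebraMap R A (h ^ n) = 0)
    {x y z : A} (hx : x * x = 0) (hzx : z * x - x * z = 2 * x) (hzy : z * y - y * z = -(2 * y))
    (hxy : x * y - y * x = z) : Sat n x y z ∧ expT n x = 1 + h • x ∧ sinhDivT n x = x := by
  have h3 : x • x • x • (1 : A) = 0 := by simp [hx]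
  have hs : sinhDivT n x = x := by simpa using sinhDivT_smul_of_cube hn x (1 : A) h3
  have he : expT n x = 1 + h • x := by simpa [hx] using expT_smul_of_cube hn x (1 : A) h3
  have hc : coshT n x = 1 := by rw [coshT_eq hn, he, hs, add_sub_cancel_right]
  refine ⟨⟨hn, by rw [hs, hzx], ?_, hxy⟩, he, hs⟩
  rw [hzy, hc, mul_one, one_mul, two_mul, neg_add, sub_eq_add_neg]

theorem matrix_algebraMap (n : ℕ) :
    algebraMap R (Matrix (Fin 2) (Fin 2) (Trunc n)) (h ^ n) = 0 := by
  rw [IsScalarTower.algebraMap_apply R (Trunc n)]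
  have : algebraMap R (Trunc n) (h ^ n) = 0 :=
    Ideal.Quotient.eq_zero_iff_mem.2 (Ideal.mem_span_singleton_self _)
  rw [this, map_zero]

theorem matrix_sat (n : ℕ) :
    Sat (A := Matrix (Fin 2) (Fin 2) (Trunc n)) n !![0, 1; 0, 0] !![0, 0; 1, 0] !![1, 0; 0, -1] ∧
    expT n (!![0, 1; 0, 0] : Matrix (Fin 2) (Fin 2) (Trunc n)) = 1 + h • !![0, 1; 0, 0] ∧
    sinhDivT n (!![0, 1; 0, 0] : Matrix (Fin 2) (Fin 2) (Trunc n)) = !![0, 1; 0, 0] :=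
  sat_of_sq_eq_zero (matrix_algebraMap n) (x := !![0, 1; 0, 0]) (y := !![0, 0; 1, 0])
    (z := !![1, 0; 0, -1])
    (by ext i j; fin_cases i <;> fin_cases j <;> simp)
    (by rw [two_mul]; ext i j; fin_cases i <;> fin_cases j <;> simp [one_add_one_eq_two])
    (by rw [two_mul]; ext i j; fin_cases i <;> fin_cases j <;> simp; norm_num)
    (by ext i j; fin_cases i <;> fin_cases j <;> simp)

/-- The two-dimensional representation. -/
def rep (n : ℕ) : Level n →ₐ[R] Matrix (Fin 2) (Fin 2) (Trunc n) := lift (matrix_sat n).1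

theorem rep_Xh : rep n (Xh n) = !![0, 1; 0, 0] := by
  rw [Xh, map_mul, map_expT, map_sinhDivT, rep, lift_X, (matrix_sat n).2.1, (matrix_sat n).2.2]
  ext i j; fin_cases i <;> fin_cases j <;> simp [Matrix.mul_apply]

theorem rep_Hh : rep n (Hh n) = !![1, h • 1; 0, -1] := by
  rw [Hh, map_mul, map_expT, rep, lift_X, lift_H, (matrix_sat n).2.1]
  ext i j; fin_cases i <;> fin_cases j <;> simp [Matrix.one_fin_two]

theorem rep_Yh_apply_one_zero : rep n (Yh n) 1 0 = 1 := by
  rw [Yh, map_sub, map_mul, map_smul, map_expT, cas_eq, map_smul, Ordered.casimir]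
  simp only [map_add, map_mul, map_smul, map_sinhDivT]
  rw [rep, lift_X, lift_Y, lift_H, (matrix_sat n).2.1, (matrix_sat n).2.2]
  simp [Matrix.one_fin_two]

/-- In the two-dimensional representation the relation is triangular: of the three matrices only
that of Y_h has a lower left entry, then only that of H_h has an upper left entry, then X_h is left.
Each leading entry is 1 in ℂ[[h]]/(hⁿ), so a vanishing coefficient there is one divisible by hⁿ. -/
theorem pow_dvd_of_combination_eq_zero {a b c : R}
    (h0 : a • Xh n + b • Hh n + c • Yh n = 0) : h ^ n ∣ a ∧ h ^ n ∣ b ∧ h ^ n ∣ c := by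
  have key : ∀ r : R, r • (1 : Trunc n) = 0 → h ^ n ∣ r := fun r hr => by
    have h1 : Ideal.Quotient.mk (Ideal.span {(h ^ n : R)}) (r * 1) = 0 := hr
    rw [mul_one] at h1
    exact Ideal.mem_span_singleton.1 (Ideal.Quotient.eq_zero_iff_mem.1 h1)
  have h1 := congrArg (rep n) h0
  rw [map_add, map_add, map_smul, map_smul, map_smul, map_zero, rep_Xh, rep_Hh] at h1
  have hc : c • (1 : Trunc n) = 0 := by
    have := congrFun (congrFun h1 1) 0
    simpa [rep_Yh_apply_one_zero] using this
  have hc' : ∀ m : Matrix (Fin 2) (Fin 2) (Trunc n), c • m = 0 := fun m => by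
    ext i j
    rw [Matrix.smul_apply, ← one_mul (m i j), ← smul_mul_assoc, hc, zero_mul, Matrix.zero_apply]
  rw [hc', add_zero] at h1
  have hb : b • (1 : Trunc n) = 0 := by simpa using congrFun (congrFun h1 0) 0
  have ha : a • (1 : Trunc n) = 0 := by
    have := congrFun (congrFun h1 0) 1
    simp only [Matrix.add_apply, Matrix.smul_apply, Matrix.zero_apply] at this
    rw [← one_mul ((!![1, h • 1; 0, -1] : Matrix _ _ _) 0 1),
      ← smul_mul_assoc, hb, zero_mul, add_zero] at this
    simpa using this
  exact ⟨key a ha, key b hb, key c hc⟩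

/-! ### Stability modulo `h ^ n` -/

/-- The span of `X_h`, `H_h` and `Y_h` modulo `h ^ n`. -/
def qLie (n : ℕ) : Submodule R (Level n) := Submodule.span R {Xh n, Hh n, Yh n}

theorem Xh_mem : Xh n ∈ qLie n := Submodule.subset_span (by simp)
theorem Hh_mem : Hh n ∈ qLie n := Submodule.subset_span (by simp)
theorem Yh_mem : Yh n ∈ qLie n := Submodule.subset_span (by simp)

theorem adHom_mem_of_basis {u : Level n} (h1 : ad n u (Xh n) ∈ qLie n)
    (h2 : ad n u (Hh n) ∈ qLie n) (h3 : ad n u (Yh n) ∈ qLie n) :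
    ∀ v ∈ qLie n, adHom n u v ∈ qLie n := by
  intro v hv
  have : qLie n ≤ (qLie n).comap (adHom n u) := by
    refine Submodule.span_le.2 ?_
    rintro w (rfl | rfl | rfl)
    exacts [h1, h2, h3]
  exact this hv

/-- Since `adHom` is an algebra homomorphism, the elements preserving the span form a subalgebra,
and the tables put the generators in it. -/
theorem ad_mem (u : Level n) : ∀ v ∈ qLie n, adHom n u v ∈ qLie n := by
  induction u using Level.induction with
  | alg r =>
    intro v hv
    rw [AlgHom.commutes]
    exact (qLie n).smul_mem r hv
  | hX =>
    obtain ⟨h1, h2, h3⟩ := table_X (n := n)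
    refine adHom_mem_of_basis ?_ ?_ ?_
    · rw [h1]; exact zero_mem _
    · rw [h2]; exact neg_mem (Submodule.smul_mem _ _ Xh_mem)
    · rw [h3]; exact Hh_mem
  | hY =>
    obtain ⟨h1, h2, h3⟩ := table_Y (n := n)
    refine adHom_mem_of_basis ?_ ?_ ?_
    · rw [h1]; exact add_mem (neg_mem Hh_mem) (Submodule.smul_mem _ _ Xh_mem)
    · rw [h2]; exact add_mem (Submodule.smul_mem _ _ Yh_mem) (Submodule.smul_mem _ _ Xh_mem)
    · rw [h3]
      exact sub_mem (sub_mem (neg_mem (Submodule.smul_mem _ _ Yh_mem))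
        (Submodule.smul_mem _ _ Hh_mem)) (Submodule.smul_mem _ _ Xh_mem)
  | hH =>
    obtain ⟨h1, h2, h3⟩ := table_H (n := n)
    refine adHom_mem_of_basis ?_ ?_ ?_
    · rw [h1]; exact Submodule.smul_mem _ _ Xh_mem
    · rw [h2]; exact Submodule.smul_mem _ _ Xh_mem
    · rw [h3]
      exact sub_mem (sub_mem (neg_mem (Submodule.smul_mem _ _ Yh_mem))
        (Submodule.smul_mem _ _ Hh_mem)) (Submodule.smul_mem _ _ Xh_mem)
  | add u v hu hv =>
    intro w hw
    rw [map_add]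
    exact add_mem (hu w hw) (hv w hw)
  | mul u v hu hv =>
    intro w hw
    rw [map_mul]
    exact hu _ (hv w hw)

end Level

/-! ### The coproduct -/

section Coproduct

open TensorProduct

variable {A : Type*} [Ring A] [Algebra R A] {n : ℕ}

theorem tensor_algebraMap (hn : algebraMap R A (h ^ n) = 0) :
    algebraMap R (A ⊗[R] A) (h ^ n) = 0 := by
  rw [Algebra.TensorProduct.algebraMap_apply, hn, zero_tmul]

theorem expT_primitive (hn : algebraMap R A (h ^ n) = 0) (x : A) :
    expT n (x ⊗ₜ[R] (1 : A) + (1 : A) ⊗ₜ[R] x) = expT n x ⊗ₜ[R] expT n x := by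
  have hL : ∀ w : A, w ⊗ₜ[R] (1 : A) = Algebra.TensorProduct.includeLeft (S := R) w :=
    fun w => rfl
  have hR : ∀ w : A, (1 : A) ⊗ₜ[R] w = Algebra.TensorProduct.includeRight w := fun w => rfl
  rw [expT_add (tensor_algebraMap hn) (by simp [Commute, SemiconjBy]), hL, hR, ← map_expT,
    ← map_expT, ← hL, ← hR]
  simp

theorem eq_of_add_self_eq {K M : Type*} [CommRing K] [AddCommGroup M] [Module K M] {a : K}
    (ha : 2 * a = 1) {u v : M} (huv : u + u = v + v) : u = v := by
  have := congrArg (a • ·) huv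
  simpa only [smul_add, ← add_smul, ← two_mul, ha, one_smul] using this

/-- The addition theorem for the commuting elements x ⊗ 1 and 1 ⊗ x. `sinhDivT_add` is stated with a
factor 2, which is invertible here and is cancelled. -/
theorem sinhDivT_primitive (hn : algebraMap R A (h ^ n) = 0) (x : A) :
    sinhDivT n (x ⊗ₜ[R] (1 : A) + (1 : A) ⊗ₜ[R] x)
      = sinhDivT n x ⊗ₜ[R] coshT n x + coshT n x ⊗ₜ[R] sinhDivT n x := by
  have hL : ∀ w : A, w ⊗ₜ[R] (1 : A) = Algebra.TensorProduct.includeLeft (S := R) w :=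
    fun w => rfl
  have hR : ∀ w : A, (1 : A) ⊗ₜ[R] w = Algebra.TensorProduct.includeRight w := fun w => rfl
  have h1 := sinhDivT_add (tensor_algebraMap hn) (a := x ⊗ₜ[R] (1 : A)) (b := (1 : A) ⊗ₜ[R] x)
    (by simp [Commute, SemiconjBy])
  refine eq_of_add_self_eq (K := R) Level.two_C_half ?_
  rw [← two_mul, h1, ← mul_add, two_mul]
  rw [hL x, hR x, ← map_sinhDivT, ← map_sinhDivT, ← map_coshT, ← map_coshT, ← hL, ← hR, ← hL,
    ← hR]
  simp

end Coproduct

/-- The left side is Δ(e)Δ(s). Since e(e - hs) = 1 + h es, both sides equal 1 ⊗ es + es ⊗ 1 + 2h es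
⊗ es. -/
theorem Ordered.tensor_identity {K A : Type*} [CommRing K] [Ring A] [Algebra K A] {h : K}
    {e s x y z : A} (o : Ordered h e s x y z) :
    (e ⊗ₜ[K] e) * (s ⊗ₜ[K] (e - h • s) + (e - h • s) ⊗ₜ[K] s)
      = (1 : A) ⊗ₜ[K] (e * s) + (e * s) ⊗ₜ[K] (e * e) := by
  simp only [mul_add, Algebra.TensorProduct.tmul_mul_tmul, mul_sub, mul_smul_comm, o.ee,
    TensorProduct.tmul_add, TensorProduct.tmul_sub, TensorProduct.add_tmul,
    TensorProduct.sub_tmul, TensorProduct.tmul_smul, ← TensorProduct.smul_tmul']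
  module

namespace Level

variable {n : ℕ}

theorem comul_expT : comul n (expT n (X n)) = expT n (X n) ⊗ₜ[R] expT n (X n) := by
  rw [map_expT, comul, lift_X, expT_primitive (sat n).pow]

theorem expT_two_mul : expT n (2 * X n) = expT n (X n) * expT n (X n) := by
  rw [two_mul, expT_add (sat n).pow (Commute.refl _)]

theorem comul_Xh : comul n (Xh n) = 1 ⊗ₜ[R] Xh n + Xh n ⊗ₜ[R] expT n (2 * X n) := by
  rw [Xh, map_mul, comul_expT, map_sinhDivT, comul, lift_X, sinhDivT_primitive (sat n).pow,
    coshT_eq (sat n).pow, expT_two_mul]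
  exact (ordered n).tensor_identity

theorem comul_Hh : comul n (Hh n) = 1 ⊗ₜ[R] Hh n + Hh n ⊗ₜ[R] expT n (2 * X n) := by
  rw [Hh, map_mul, comul_expT, comul, lift_H, expT_two_mul, add_mul,
    Algebra.TensorProduct.tmul_mul_tmul, Algebra.TensorProduct.tmul_mul_tmul,
    expT_neg_mul (sat n).pow, add_comm]

theorem comul_Y_mul_expT : comul n (Y n * expT n (X n))
    = 1 ⊗ₜ[R] (Y n * expT n (X n)) + (Y n * expT n (X n)) ⊗ₜ[R] expT n (2 * X n) := by
  rw [map_mul, comul_expT, comul, lift_Y, expT_two_mul, add_mul,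
    Algebra.TensorProduct.tmul_mul_tmul, Algebra.TensorProduct.tmul_mul_tmul,
    expT_neg_mul (sat n).pow, add_comm]

/-- The element Ye has the same form of coproduct as H_h; the last summand is the defect of the
Casimir element from having it. -/
theorem comul_Yh : comul n (Yh n) = 1 ⊗ₜ[R] Yh n + Yh n ⊗ₜ[R] expT n (2 * X n)
    + (2 * h) • (1 ⊗ₜ[R] cas n + cas n ⊗ₜ[R] expT n (2 * X n) - comul n (cas n)) := by
  rw [Yh, map_sub, comul_Y_mul_expT, map_smul, TensorProduct.tmul_sub, TensorProduct.sub_tmul,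
    TensorProduct.tmul_smul, ← TensorProduct.smul_tmul', smul_sub, smul_add]
  abel

end Level

/-! ### The antisymmetry of the bracket -/

theorem exists_semilinear_involution {K M : Type*} [CommRing K] [AddCommGroup M] [Module K M]
    (τ : K →+* K) (hτ : ∀ r, τ (τ r) = r) {ι : Type*} [Fintype ι] (B : Module.Basis ι K M) :
    ∃ σ : M →ₛₗ[τ] M, (∀ i, σ (B i) = B i) ∧ ∀ a, σ (σ a) = a := by
  classical
  -- The involution applies τ to the coordinates.
  let σ : M →ₛₗ[τ] M :=
    { toFun := fun a => ∑ i, τ (B.repr a i) • B i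
      map_add' := fun a b => by simp [add_smul, Finset.sum_add_distrib]
      map_smul' := fun r a => by simp [mul_smul, Finset.smul_sum] }
  have hB : ∀ i, σ (B i) = B i := fun i => by
    change ∑ j, τ (B.repr (B i) j) • B j = B i
    rw [Finset.sum_eq_single i]
    · simp
    · intro j _ hj
      simp [hj.symm]
    · simp
  refine ⟨σ, hB, fun a => ?_⟩
  have h1 : σ a = ∑ i, τ (B.repr a i) • B i := rfl
  rw [h1, map_sum]
  simp only [map_smulₛₗ, hτ, hB, B.sum_repr]

/-- Both sides are τ-semilinear in a and in b, so it is enough to compare them on basis vectors,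
which σ fixes. -/
theorem antisymm_of_basis {K M : Type*} [CommRing K] [AddCommGroup M] [Module K M]
    {τ : K →+* K} {ι : Type*} [Fintype ι] (B : Module.Basis ι K M) (br : M →ₗ[K] M →ₗ[K] M)
    (σ : M →ₛₗ[τ] M) (hB : ∀ i, σ (B i) = B i)
    (hbr : ∀ i j, σ (br (B i) (B j)) = -br (B j) (B i)) (a b : M) :
    σ (br a b) = -br (σ b) (σ a) := by
  rw [← B.sum_repr a, ← B.sum_repr b]
  simp only [map_sum, map_smulₛₗ, LinearMap.sum_apply, LinearMap.smul_apply, hB, hbr,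
    ← Finset.sum_neg_distrib, smul_neg, RingHom.id_apply, Finset.smul_sum]
  rw [Finset.sum_comm]
  refine Finset.sum_congr rfl fun i _ => Finset.sum_congr rfl fun j _ => ?_
  rw [smul_comm]

/-- Changing the sign of h in a bracket of two basis vectors gives minus the bracket in the other
order. In particular [Y_h, Y_h] may be nonzero because its coefficient is odd in h. -/
theorem antisymm_of_brackets {K M : Type*} [CommRing K] [AddCommGroup M] [Module K M]
    {τ : K →+* K} {h : K} (hh : τ h = -h) (B : Module.Basis (Fin 3) K M)
    (br : M →ₗ[K] M →ₗ[K] M) (σ : M →ₛₗ[τ] M) (hB : ∀ i, σ (B i) = B i)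
    (h0 : br (B 0) (B 0) = 0 ∧ br (B 0) (B 1) = -((2 : K) • B 0) ∧
      br (B 0) (B 2) = B 1 - (2 * h) • B 0)
    (h1 : br (B 1) (B 0) = (2 : K) • B 0 ∧ br (B 1) (B 1) = 0 ∧
      br (B 1) (B 2) = -((2 : K) • B 2) - (2 * h) • B 1 + h ^ 2 • B 0)
    (h2 : br (B 2) (B 0) = -B 1 - (2 * h) • B 0 ∧
      br (B 2) (B 1) = (2 : K) • B 2 - (2 * h) • B 1 - h ^ 2 • B 0 ∧
      br (B 2) (B 2) = -((4 * h) • B 2)) (a b : M) :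
    σ (br a b) = -br (σ b) (σ a) := by
  refine antisymm_of_basis B br σ hB ?_ a b
  obtain ⟨h00, h01, h02⟩ := h0
  obtain ⟨h10, h11, h12⟩ := h1
  obtain ⟨h20, h21, h22⟩ := h2
  have h4 : τ 4 = 4 := map_ofNat τ 4
  have h2 : τ 2 = 2 := map_ofNat τ 2
  simp only [Fin.forall_fin_succ, Fin.succ_zero_eq_one, Fin.succ_one_eq_two, IsEmpty.forall_iff,
    and_true, h00, h01, h02, h10, h11, h12, h20, h21, h22, map_add, map_sub, map_neg, map_zero,
    map_smulₛₗ, hB, map_mul, map_pow, hh, h2, h4]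
  refine ⟨⟨?_, ?_, ?_⟩, ⟨?_, ?_, ?_⟩, ?_, ?_, ?_⟩ <;> first | trivial | module

/-! ### The complete algebra -/

/-- Completeness of ℂ[[h]]: the coefficient of h^k no longer changes from index k + 1 on, which
gives the coefficients of the limit. -/
theorem exists_limit (a : ℕ → R) (ha : ∀ n, h ^ n ∣ a (n + 1) - a n) :
    ∃ l : R, ∀ n, h ^ n ∣ l - a n := by
  have hc : ∀ m n, m + 1 ≤ n → PowerSeries.coeff m (a n) = PowerSeries.coeff m (a (m + 1)) := by
    intro m n hmn
    induction n, hmn using Nat.le_induction with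
    | base => rfl
    | succ n hn ih =>
      have := PowerSeries.X_pow_dvd_iff.1 (ha n) m hn
      rw [map_sub, sub_eq_zero] at this
      rw [this, ih]
  refine ⟨PowerSeries.mk fun k => PowerSeries.coeff k (a (k + 1)), fun n => ?_⟩
  refine PowerSeries.X_pow_dvd_iff.2 fun m hm => ?_
  rw [map_sub, PowerSeries.coeff_mk, hc m n hm, sub_self]

theorem eq_zero_of_forall_pow_dvd {a : R} (ha : ∀ n, h ^ n ∣ a) : a = 0 :=
  PowerSeries.ext fun m => PowerSeries.X_pow_dvd_iff.1 (ha (m + 1)) m (Nat.lt_succ_self m)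

theorem Level.smul_eq_of_dvd {n : ℕ} {a b : R} (hab : h ^ n ∣ a - b) (u : Level n) :
    a • u = b • u := by
  obtain ⟨c, hc⟩ := hab
  rw [← sub_eq_zero, ← sub_smul, hc, Algebra.smul_def, map_mul, (Level.sat n).pow, zero_mul,
    zero_mul]

namespace Uh

theorem ext_level {u v : Uh} (huv : ∀ n, u.1 n = v.1 n) : u = v := Subtype.ext (funext huv)

theorem linearIndependent : LinearIndependent R ![Xh, Hh, Yh] := by
  rw [Fintype.linearIndependent_iff]
  intro g hg
  rw [Fin.sum_univ_three] at hg
  have key (n : ℕ) := Level.pow_dvd_of_combination_eq_zero (n := n)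
    (congrArg (fun u : Uh => u.1 n) hg)
  intro i
  fin_cases i
  · exact eq_zero_of_forall_pow_dvd fun n => (key n).1
  · exact eq_zero_of_forall_pow_dvd fun n => (key n).2.1
  · exact eq_zero_of_forall_pow_dvd fun n => (key n).2.2

/-- The uncompleted span is already closed: coefficients of w modulo `h ^ n` are unique modulo `h ^
n`, hence coherent in n, and their limits express w. -/
theorem mem_qLie_iff (w : Uh) : w ∈ qLie ↔ ∀ n, w.1 n ∈ Level.qLie n := by
  constructor
  · intro hw n
    obtain ⟨a, b, c, rfl⟩ := Submodule.mem_span_triple.1 hw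
    exact Submodule.mem_span_triple.2 ⟨a, b, c, rfl⟩
  · intro hw
    choose a b c habc using fun n => Submodule.mem_span_triple.1 (hw n)
    have key (n : ℕ) : h ^ n ∣ a (n + 1) - a n ∧ h ^ n ∣ b (n + 1) - b n ∧
        h ^ n ∣ c (n + 1) - c n := by
      -- The coefficients chosen at n + 1, once projected, and those chosen at n express the same
      -- element, so their differences form a linear relation modulo `h ^ n`.
      refine Level.pow_dvd_of_combination_eq_zero ?_
      have h1 := congrArg (Level.proj n) (habc (n + 1))
      rw [w.2 n, ← habc n, map_add, map_add, map_smul, map_smul, map_smul,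
        show Level.proj n (Level.Xh (n + 1)) = Level.Xh n from Xh.2 n,
        show Level.proj n (Level.Hh (n + 1)) = Level.Hh n from Hh.2 n,
        show Level.proj n (Level.Yh (n + 1)) = Level.Yh n from Yh.2 n] at h1
      rw [← sub_eq_zero] at h1
      rw [← h1]
      simp only [sub_smul]
      abel
    obtain ⟨a', ha⟩ := exists_limit a fun n => (key n).1
    obtain ⟨b', hb⟩ := exists_limit b fun n => (key n).2.1
    obtain ⟨c', hc⟩ := exists_limit c fun n => (key n).2.2
    refine Submodule.mem_span_triple.2 ⟨a', b', c', ext_level fun n => ?_⟩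
    rw [← habc n]
    change a' • Level.Xh n + b' • Level.Hh n + c' • Level.Yh n = _
    rw [Level.smul_eq_of_dvd (ha n), Level.smul_eq_of_dvd (hb n), Level.smul_eq_of_dvd (hc n)]

theorem ad_mem_qLie (u v : Uh) (hv : v ∈ qLie) : ad u v ∈ qLie :=
  (mem_qLie_iff _).2 fun n => Level.ad_mem (u.1 n) _ ((mem_qLie_iff v).1 hv n)

/-- The bracket `[a, b] = a ▷ b`. -/
def bracket : qLie →ₗ[R] qLie →ₗ[R] qLie :=
  LinearMap.mk₂ R (fun a b => ⟨ad a b, ad_mem_qLie _ _ b.2⟩)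
    (fun a a' b => Subtype.ext <| ext_level fun n =>
      DFunLike.congr_fun (map_add (Level.adHom n) (a.1.1 n) (a'.1.1 n)) (b.1.1 n))
    (fun r a b => Subtype.ext <| ext_level fun n =>
      DFunLike.congr_fun (map_smul (Level.adHom n) r (a.1.1 n)) (b.1.1 n))
    (fun a b b' => Subtype.ext <| ext_level fun n =>
      map_add (Level.adHom n (a.1.1 n)) (b.1.1 n) (b'.1.1 n))
    (fun r a b => Subtype.ext <| ext_level fun n =>
      map_smul (Level.adHom n (a.1.1 n)) r (b.1.1 n))

theorem span_range_eq : Submodule.span R (Set.range ![Xh, Hh, Yh]) = qLie := by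
  rw [qLie]
  congr 1
  ext u
  simp only [Matrix.range_cons, Matrix.range_empty, Set.mem_union, Set.mem_singleton_iff,
    Set.mem_empty_iff_false, or_false, Set.mem_insert_iff]

/-- The basis `X_h, H_h, Y_h`. -/
def basis : Module.Basis (Fin 3) R qLie :=
  (Module.Basis.span linearIndependent).map
    (LinearEquiv.ofEq _ _ span_range_eq)

theorem basis_apply (i : Fin 3) : (basis i : Uh) = ![Xh, Hh, Yh] i := by
  rw [basis, Module.Basis.map_apply, LinearEquiv.coe_ofEq_apply, Module.Basis.span_apply]

theorem table_X : ad X Xh = 0 ∧ ad X Hh = -((2 : R) • Xh) ∧ ad X Yh = Hh :=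
  ⟨ext_level fun _ => Level.table_X.1, ext_level fun _ => Level.table_X.2.1,
    ext_level fun _ => Level.table_X.2.2⟩

theorem table_H : ad H Xh = (2 : R) • Xh ∧ ad H Hh = (4 * h) • Xh ∧
    ad H Yh = -((2 : R) • Yh) - (2 * h) • Hh - h ^ 2 • Xh :=
  ⟨ext_level fun _ => Level.table_H.1, ext_level fun _ => Level.table_H.2.1,
    ext_level fun _ => Level.table_H.2.2⟩

theorem table_Y : ad Y Xh = -Hh + (2 * h) • Xh ∧ ad Y Hh = (2 : R) • Yh + (3 * h ^ 2) • Xh ∧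
    ad Y Yh = -((2 * h) • Yh) - h ^ 2 • Hh - h ^ 3 • Xh :=
  ⟨ext_level fun _ => Level.table_Y.1, ext_level fun _ => Level.table_Y.2.1,
    ext_level fun _ => Level.table_Y.2.2⟩

theorem brackets_Xh : ad Xh Xh = 0 ∧ ad Xh Hh = -((2 : R) • Xh) ∧
    ad Xh Yh = Hh - (2 * h) • Xh :=
  ⟨ext_level fun _ => Level.brackets_Xh.1, ext_level fun _ => Level.brackets_Xh.2.1,
    ext_level fun _ => Level.brackets_Xh.2.2⟩

theorem brackets_Hh : ad Hh Xh = (2 : R) • Xh ∧ ad Hh Hh = 0 ∧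
    ad Hh Yh = -((2 : R) • Yh) - (2 * h) • Hh + h ^ 2 • Xh :=
  ⟨ext_level fun _ => Level.brackets_Hh.1, ext_level fun _ => Level.brackets_Hh.2.1,
    ext_level fun _ => Level.brackets_Hh.2.2⟩

theorem brackets_Yh : ad Yh Xh = -Hh - (2 * h) • Xh ∧
    ad Yh Hh = (2 : R) • Yh - (2 * h) • Hh - h ^ 2 • Xh ∧
    ad Yh Yh = -((4 * h) • Yh) :=
  ⟨ext_level fun _ => Level.brackets_Yh.1, ext_level fun _ => Level.brackets_Yh.2.1,
    ext_level fun _ => Level.brackets_Yh.2.2⟩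

theorem evalNegHom_evalNegHom (r : R) :
    (PowerSeries.evalNegHom : R →+* R) ((PowerSeries.evalNegHom : R →+* R) r) = r := by
  rw [PowerSeries.evalNegHom, PowerSeries.rescale_rescale]
  simp

theorem exists_antisymm : ∃ br : qLie →ₗ[R] qLie →ₗ[R] qLie,
    (∀ a b : qLie, (br a b : Uh) = ad (a : Uh) (b : Uh)) ∧
    ∃ σ : qLie →ₛₗ[(PowerSeries.evalNegHom : R →+* R)] qLie,
      (∀ a : qLie, (a : Uh) = Xh ∨ (a : Uh) = Hh ∨ (a : Uh) = Yh → σ a = a) ∧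
      (∀ a : qLie, σ (σ a) = a) ∧
      ∀ a b : qLie, σ (br a b) = -br (σ b) (σ a) := by
  refine ⟨bracket, fun a b => rfl, ?_⟩
  obtain ⟨σ, hB, hσ⟩ := exists_semilinear_involution (K := R) (M := qLie) _
    evalNegHom_evalNegHom basis
  have e0 : (basis 0 : Uh) = Xh := basis_apply 0
  have e1 : (basis 1 : Uh) = Hh := basis_apply 1
  have e2 : (basis 2 : Uh) = Yh := basis_apply 2
  refine ⟨σ, ?_, hσ, ?_⟩
  · rintro a (ha | ha | ha)
    · rw [show a = basis 0 from Subtype.ext (ha.trans e0.symm), hB]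
    · rw [show a = basis 1 from Subtype.ext (ha.trans e1.symm), hB]
    · rw [show a = basis 2 from Subtype.ext (ha.trans e2.symm), hB]
  -- The nine brackets are equations in the algebra; through this identity they become equations in
  -- the span, in terms of its basis.
  · have key (i j : Fin 3) : (bracket (basis i) (basis j) : Uh)
        = ad (basis i : Uh) (basis j : Uh) := rfl
    obtain ⟨h00, h01, h02⟩ := brackets_Xh
    obtain ⟨h10, h11, h12⟩ := brackets_Hh
    obtain ⟨h20, h21, h22⟩ := brackets_Yh
    refine antisymm_of_brackets (K := R) (M := qLie) PowerSeries.evalNegHom_X basis bracket σ hB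
      ⟨?_, ?_, ?_⟩ ⟨?_, ?_, ?_⟩ ⟨?_, ?_, ?_⟩ <;> apply Subtype.ext <;> rw [key] <;>
      simp only [Submodule.coe_add, Submodule.coe_sub, Submodule.coe_neg, Submodule.coe_smul,
        Submodule.coe_zero, e0, e1, e2, h00, h01, h02, h10, h11, h12, h20, h21, h22]

end Uh

end JordanianSl2

end

open JordanianSl2 JordanianSl2.Uh in
theorem mainTheorem9 :
    -- the span of `X_h, H_h, Y_h` is stable under the left adjoint action
    (∀ u : Uh, ∀ v ∈ qLie, ad u v ∈ qLie) ∧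
    -- it is free of rank three on these elements, and `C` is central
    LinearIndependent R ![Xh, Hh, Yh] ∧
    (∀ u : Uh, casimir * u = u * casimir) ∧
    -- the action of the generators
    (ad X Xh = 0 ∧
      ad H Xh = (2 : R) • Xh ∧
      ad Y Xh = -Hh + (2 * h) • Xh ∧
      ad X Hh = -((2 : R) • Xh) ∧
      ad H Hh = (4 * h) • Xh ∧
      ad Y Hh = (2 : R) • Yh + (3 * h ^ 2) • Xh ∧
      ad X Yh = Hh ∧
      ad H Yh = -((2 : R) • Yh) - (2 * h) • Hh - h ^ 2 • Xh ∧
      ad Y Yh = -((2 * h) • Yh) - h ^ 2 • Hh - h ^ 3 • Xh) ∧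
    -- the quantum Lie brackets
    (ad Xh Xh = 0 ∧
      ad Xh Hh = -((2 : R) • Xh) ∧
      ad Xh Yh = Hh - (2 * h) • Xh ∧
      ad Hh Xh = (2 : R) • Xh ∧
      ad Hh Hh = 0 ∧
      ad Hh Yh = -((2 : R) • Yh) - (2 * h) • Hh + h ^ 2 • Xh ∧
      ad Yh Xh = -Hh - (2 * h) • Xh ∧
      ad Yh Hh = (2 : R) • Yh - (2 * h) • Hh - h ^ 2 • Xh ∧
      ad Yh Yh = -((4 * h) • Yh)) ∧
    -- `h`-antisymmetry of the bracket, with respect to the involution of the span that fixes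
    -- `X_h, H_h, Y_h` and is semilinear for `h ↦ -h`
    (∃ br : qLie →ₗ[R] qLie →ₗ[R] qLie,
      (∀ a b : qLie, (br a b : Uh) = ad (a : Uh) (b : Uh)) ∧
      ∃ σ : qLie →ₛₗ[(PowerSeries.evalNegHom : R →+* R)] qLie,
        (∀ a : qLie, (a : Uh) = Xh ∨ (a : Uh) = Hh ∨ (a : Uh) = Yh → σ a = a) ∧
        (∀ a : qLie, σ (σ a) = a) ∧
        ∀ a b : qLie, σ (br a b) = -br (σ b) (σ a)) ∧
    -- the coproduct
    comul Xh = tmul 1 Xh + tmul Xh (exph (2 * X)) ∧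
    comul Hh = tmul 1 Hh + tmul Hh (exph (2 * X)) ∧
    comul Yh = tmul 1 Yh + tmul Yh (exph (2 * X))
      + (2 * h) • (tmul 1 casimir + tmul casimir (exph (2 * X)) - comul casimir) := by
  refine ⟨ad_mem_qLie, linearIndependent,
    fun u => ext_level fun n => (Level.cas_commute (u.1 n)).eq, ?_, ?_, exists_antisymm,
    Subtype.ext (funext fun _ => Level.comul_Xh), Subtype.ext (funext fun _ => Level.comul_Hh),
    Subtype.ext (funext fun _ => Level.comul_Yh)⟩
  · obtain ⟨x1, x2, x3⟩ := table_X
    obtain ⟨z1, z2, z3⟩ := table_H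
    obtain ⟨y1, y2, y3⟩ := table_Y
    exact ⟨x1, z1, y1, x2, z2, y2, x3, z3, y3⟩
  · obtain ⟨x1, x2, x3⟩ := brackets_Xh
    obtain ⟨z1, z2, z3⟩ := brackets_Hh
    obtain ⟨y1, y2, y3⟩ := brackets_Yh
    exact ⟨x1, x2, x3, z1, z2, z3, y1, y2, y3⟩
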